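/- Let $U\subseteq\mathbb R^m$ be open and $\theta\in U$. Consider the parameterized program $$\min_{x\in\mathbb R^n} f(x;\theta)\quad\text{s.t.}\quad A(\theta)x=b(\theta),\quad G(\theta)x\le h(\theta),$$ with $A(\theta)\in\mathbb R^{p\times n}$, $G(\theta)\in\mathbb R^{q\times n}$. Assume that $f(\cdot;\theta)$ is convex on $\mathbb R^n$ at the given $\theta$, that $f(\cdot;\theta')$ is differentiable for all $\theta'\in U$, that $(\theta',x)\mapsto\nabla_xf(x;\theta')$ is $C^1$ on $U\times\mathbb R^n$, and that $A,b,G,h$ are $C^1$ on $U$. **Implicit Jacobian.** For $z=(x,\lambda,\nu)$ put $$F(z,\theta)=\bigl(\nabla_x f(x;\theta)+A(\theta)^T\lambda+G(\theta)^T\nu,\ \ A(\theta)x-b(\theta),\ \ \mathrm{diag}(\nu)(G(\theta)x-h(\theta))\bigr).$$ Let $z^\star=(x^\star,\lambda^\star,\nu^\star)$ satisfy the KKT conditions at $\theta$: $F(z^\star,\theta)=0$, $G(\theta)x^\star\le h(\theta)$, $\nu^\star\ge0$. Assume that the Jacobian $\mathcal J_{F;z}=\nabla_zF(z^\star,\theta)$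 is invertible, and let $\frac{\partial x^\star}{\partial\theta}$ be the $x$-component of $-\mathcal J_{F;z}^{-1}\,\mathcal J_{F;\theta}$, where $\mathcal J_{F;\theta}=\nabla_\theta F(z^\star,\theta)$. **ADMM.** For $\rho>0$ let $$\mathcal L(x,s,\lambda,\nu;\theta)=f(x;\theta)+\langle\lambda,Ax-b\rangle+\langle\nu,Gx+s-h\rangle+\tfrac\rho2\bigl(\|Ax-b\|^2+\|Gx+s-h\|^2\bigr),$$ and, from arbitrary $s_0,\lambda_0,\nu_0$, let $$x_{k+1}\in\arg\min_x\mathcal L(x,s_k,\lambda_k,\nu_k;\theta),\qquad s_{k+1}=\arg\min_{s\ge0}\mathcal L(x_{k+1},s,\lambda_k,\nu_k;\theta),$$ $$\lambda_{k+1}=\lambda_k+\rho(Ax_{k+1}-b),\qquad \nu_{k+1}=\nu_k+\rho(Gx_{k+1}+s_{k+1}-h).$$ Assume that the Hessians $\nabla_x^2\mathcal L(x_{k+1})=\nabla_x^2\mathcal L(x_{k+1},s_k,\lambda_k,\nu_k;\theta)=\nabla_x^2f(x_{k+1};\theta)+\rho A^TA+\rho G^TG$ are invertible for all $k\ge0$.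 **Alt-Diff.** From arbitrary initial matrices $\frac{\partial s_0}{\partial\theta},\frac{\partial\lambda_0}{\partial\theta},\frac{\partial\nu_0}{\partial\theta}$, define for $k\ge 0$ $$\frac{\partial x_{k+1}}{\partial\theta}=-\bigl(\nabla_x^2\mathcal L(x_{k+1})\bigr)^{-1}\nabla_{x,\theta}\mathcal L(x_{k+1}),$$ $$\frac{\partial s_{k+1}}{\partial\theta}=-\frac1\rho\,\mathrm{diag}\bigl(\mathrm{sgn}(s_{k+1})\bigr)\Bigl(\frac{\partial\nu_k}{\partial\theta}+\rho\frac{\partial(Gx_{k+1}-h)}{\partial\theta}\Bigr),$$ $$\frac{\partial\lambda_{k+1}}{\partial\theta}=\frac{\partial\lambda_k}{\partial\theta}+\rho\frac{\partial(Ax_{k+1}-b)}{\partial\theta},\qquad \frac{\partial\nu_{k+1}}{\partial\theta}=\frac{\partial\nu_k}{\partial\theta}+\rho\frac{\partial(Gx_{k+1}+s_{k+1}-h)}{\partial\theta}.$$ Here $\nabla_{x,\theta}\mathcal L(x_{k+1})=\frac{\partial}{\partial\theta}\nabla_x\mathcal L(x_{k+1},s_k,\lambda_k,\nu_k;\theta)$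 is taken with $x_{k+1}$ held fixed and with $s_k,\lambda_k,\nu_k$ depending on $\theta$ through their Jacobians; the other derivatives are total derivatives by the chain rule, e.g. $\frac{\partial(Ax_{k+1}-b)}{\partial\theta}v=(DA[v])x_{k+1}+A\frac{\partial x_{k+1}}{\partial\theta}v-Db[v]$. The function $\mathrm{sgn}$ acts entrywise, with $\mathrm{sgn}(t)=1$ for $t>0$ and $\mathrm{sgn}(t)=0$ otherwise. **Theorem.** Under these assumptions the matrices $\frac{\partial x_k}{\partial\theta}$ converge, and $$\lim_{k\to\infty}\frac{\partial x_k}{\partial\theta}=\frac{\partial x^\star}{\partial\theta}.$$ -/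

import Mathlib

namespace AltDiff

/-- Euclidean space of dimension `d`. -/
abbrev E (d : ℕ) : Type := EuclideanSpace ℝ (Fin d)

/-- The data of the parameterized program `min f(x; θ)` subject to `A(θ) x = b(θ)`, `G(θ) x ≤ h(θ)`,
with parameter `θ ∈ ℝ^m`, variable `x ∈ ℝ^n`, `p` equalities and `q` inequalities. The matrices `A(θ)`
and `G(θ)` are identified with the linear maps they define. -/
structure Program (m n p q : ℕ) where
  f : E m → E n → ℝ
  A : E m → E n →L[ℝ] E p
  b : E m → E p
  G : E m → E n →L[ℝ] E q
  h : E m → E q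

/-- The Jacobian with respect to `θ` of the composite quantity `F(θ, v(θ))`, where `v` is the current
value of `v(θ)` and `Dv` is its Jacobian (chain rule). -/
noncomputable def totalJac {m : ℕ} {V W : Type*} [NormedAddCommGroup V] [NormedSpace ℝ V]
    [NormedAddCommGroup W] [NormedSpace ℝ W] (F : E m × V → W) (θ : E m) (v : V)
    (Dv : E m →L[ℝ] V) : E m →L[ℝ] W :=
  (fderiv ℝ F (θ, v)).comp ((ContinuousLinearMap.id ℝ (E m)).prod Dv)

namespace Program

variable {m n p q : ℕ} (P : Program m n p q) (ρ : ℝ)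

/-- The augmented Lagrangian `L(x, s, lam, nu; θ)` with penalty parameter `ρ`. -/
noncomputable def augLag (θ : E m) (x : E n) (s : E q) (lam : E p) (nu : E q) : ℝ :=
  P.f θ x + inner ℝ lam (P.A θ x - P.b θ) + inner ℝ nu (P.G θ x + s - P.h θ)
    + ρ / 2 * (‖P.A θ x - P.b θ‖ ^ 2 + ‖P.G θ x + s - P.h θ‖ ^ 2)

/-- `∇_x L(x, s, lam, nu; θ)`. -/
noncomputable def gradL (θ : E m) (x : E n) (s : E q) (lam : E p) (nu : E q) : E n :=
  gradient (fun y => P.augLag ρ θ y s lam nu) x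

/-- The Hessian `∇_x^2 L(x, s, lam, nu; θ)`. -/
noncomputable def hessL (θ : E m) (x : E n) (s : E q) (lam : E p) (nu : E q) : E n →L[ℝ] E n :=
  fderiv ℝ (fun y => P.gradL ρ θ y s lam nu) x

/-- `∇_{x,θ} L`: the Jacobian in `θ` of `∇_x L(x, s, lam, nu; θ)`, with `x` held fixed and with
`s, lam, nu` depending on `θ` through their Jacobians `S, Lam, Nu`. -/
noncomputable def mixedL (θ : E m) (x : E n) (s : E q) (lam : E p) (nu : E q)
    (S : E m →L[ℝ] E q) (Lam : E m →L[ℝ] E p) (Nu : E m →L[ℝ] E q) : E m →L[ℝ] E n :=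
  totalJac (fun w : E m × (E q × E p × E q) => P.gradL ρ w.1 x w.2.1 w.2.2.1 w.2.2.2)
    θ (s, lam, nu) (S.prod (Lam.prod Nu))

/-- `∂(A x - b)/∂θ`, where `x` has Jacobian `X`. -/
noncomputable def eqJac (θ : E m) (x : E n) (X : E m →L[ℝ] E n) : E m →L[ℝ] E p :=
  totalJac (fun w : E m × E n => P.A w.1 w.2 - P.b w.1) θ x X

/-- `∂(G x - h)/∂θ`, where `x` has Jacobian `X`. -/
noncomputable def ineqJac (θ : E m) (x : E n) (X : E m →L[ℝ] E n) : E m →L[ℝ] E q :=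
  totalJac (fun w : E m × E n => P.G w.1 w.2 - P.h w.1) θ x X

/-- `∂(G x + s - h)/∂θ`, where `x` and `s` have Jacobians `X` and `S`. -/
noncomputable def slackJac (θ : E m) (x : E n) (s : E q) (X : E m →L[ℝ] E n)
    (S : E m →L[ℝ] E q) : E m →L[ℝ] E q :=
  totalJac (fun w : E m × (E n × E q) => P.G w.1 w.2.1 + w.2.2 - P.h w.1) θ (x, s) (X.prod S)

/-- The sequences `x, s, lam, nu` are generated at the parameter `θ` by the ADMM updates, from
arbitrary initial values `s 0, lam 0, nu 0` (the value `x 0` is never used). -/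
structure IsADMM (θ : E m) (x : ℕ → E n) (s : ℕ → E q) (lam : ℕ → E p) (nu : ℕ → E q) : Prop where
  primal : ∀ k, IsMinOn (fun y => P.augLag ρ θ y (s k) (lam k) (nu k)) Set.univ (x (k + 1))
  slack_nonneg : ∀ k i, 0 ≤ s (k + 1) i
  slack : ∀ k, IsMinOn (fun t => P.augLag ρ θ (x (k + 1)) t (lam k) (nu k))
    {t : E q | ∀ i, 0 ≤ t i} (s (k + 1))
  dual_eq : ∀ k, lam (k + 1) = lam k + ρ • (P.A θ (x (k + 1)) - P.b θ)
  dual_ineq : ∀ k, nu (k + 1) = nu k + ρ • (P.G θ (x (k + 1)) + s (k + 1) - P.h θ)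

/-- The factor `sgn` in the differentiated slack update: `1` at positive arguments and `0` otherwise
(the derivative of the ReLU through which the slack variable is updated). -/
noncomputable def sgn (t : ℝ) : ℝ := if 0 < t then 1 else 0

/-- The sequences `X, S, Lam, Nu` (the Jacobians `∂x_k/∂θ, ∂s_k/∂θ, ∂λ_k/∂θ, ∂ν_k/∂θ`) are generated
by the differentiated updates along the sequences `x, s, lam, nu`, from arbitrary initial values
`S 0, Lam 0, Nu 0` (the value `X 0` is never used). -/
structure IsAltDiff (θ : E m) (x : ℕ → E n) (s : ℕ → E q) (lam : ℕ → E p) (nu : ℕ → E q)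
    (X : ℕ → E m →L[ℝ] E n) (S : ℕ → E m →L[ℝ] E q) (Lam : ℕ → E m →L[ℝ] E p)
    (Nu : ℕ → E m →L[ℝ] E q) : Prop where
  primal : ∀ k, X (k + 1) =
    -((P.hessL ρ θ (x (k + 1)) (s k) (lam k) (nu k)).inverse.comp
      (P.mixedL ρ θ (x (k + 1)) (s k) (lam k) (nu k) (S k) (Lam k) (Nu k)))
  slack : ∀ k v i, S (k + 1) v i =
    -(1 / ρ) * sgn (s (k + 1) i) * (Nu k v i + ρ * P.ineqJac θ (x (k + 1)) (X (k + 1)) v i)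
  dual_eq : ∀ k, Lam (k + 1) = Lam k + ρ • P.eqJac θ (x (k + 1)) (X (k + 1))
  dual_ineq : ∀ k, Nu (k + 1) =
    Nu k + ρ • P.slackJac θ (x (k + 1)) (s (k + 1)) (X (k + 1)) (S (k + 1))

/-- The KKT map `F(z, θ)` with `z = (x, lam, nu)`: stationarity, equality constraints and
complementarity `diag(nu) (G x - h)`. -/
noncomputable def kktMap (θ : E m) (z : E n × E p × E q) : E n × E p × E q :=
  (gradient (P.f θ) z.1 + (P.A θ).adjoint z.2.1 + (P.G θ).adjoint z.2.2,
    P.A θ z.1 - P.b θ,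
    WithLp.toLp 2 (fun i => z.2.2 i * (P.G θ z.1 - P.h θ) i))

/-- `(x, lam, nu)` is an optimal primal-dual triple at `θ`: it satisfies the KKT conditions,
including primal and dual feasibility of the inequalities. -/
structure IsKKT (θ : E m) (x : E n) (lam : E p) (nu : E q) : Prop where
  zero : P.kktMap θ (x, lam, nu) = 0
  primal_feasible : ∀ i, P.G θ x i ≤ P.h θ i
  dual_nonneg : ∀ i, 0 ≤ nu i

/-- The Jacobian of the KKT map with respect to `z = (x, lam, nu)`. -/
noncomputable def kktJac (θ : E m) (z : E n × E p × E q) :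
    (E n × E p × E q) →L[ℝ] (E n × E p × E q) :=
  fderiv ℝ (fun z' => P.kktMap θ z') z

/-- The Jacobian of the KKT map with respect to `θ`. -/
noncomputable def kktJacParam (θ : E m) (z : E n × E p × E q) : E m →L[ℝ] (E n × E p × E q) :=
  fderiv ℝ (fun θ' => P.kktMap θ' z) θ

/-- The Jacobian `∂x⋆/∂θ` obtained by implicit differentiation of the KKT conditions: the
`x`-component of `-[J_{F;z}]⁻¹ J_{F;θ}`. -/
noncomputable def implicitJac (θ : E m) (z : E n × E p × E q) : E m →L[ℝ] E n :=
  (ContinuousLinearMap.fst ℝ (E n) (E p × E q)).comp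
    (-((P.kktJac θ z).inverse.comp (P.kktJacParam θ z)))

end Program

end AltDiff

namespace AltDiff

open Filter Topology

theorem tendsto_clm_apply {V W ι : Type*} [NormedAddCommGroup V] [NormedSpace ℝ V]
    [NormedAddCommGroup W] [NormedSpace ℝ W] {l : Filter ι} {T : ι → V →L[ℝ] W} {T' : V →L[ℝ] W}
    {v : ι → V} {v' : V} (hT : Tendsto T l (𝓝 T')) (hv : Tendsto v l (𝓝 v')) :
    Tendsto (fun i => T i (v i)) l (𝓝 (T' v')) :=
  (isBoundedBilinearMap_apply.continuous.tendsto (T', v')).comp (hT.prodMk_nhds hv)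

theorem tendsto_zero_of_le_mul_add {a ε : ℕ → ℝ} {c : ℝ} (hc0 : 0 ≤ c) (hc1 : c < 1)
    (ha : ∀ k, 0 ≤ a k) (hε : Tendsto ε atTop (𝓝 0))
    (h : ∀ᶠ k in atTop, a (k + 1) ≤ c * a k + ε k) : Tendsto a atTop (𝓝 0) := by
  rw [Metric.tendsto_atTop]
  intro δ hδ
  have hpos : 0 < (1 - c) * (δ / 2) := mul_pos (sub_pos.2 hc1) (half_pos hδ)
  obtain ⟨N, hN⟩ := eventually_atTop.1 (h.and (hε.eventually (gt_mem_nhds hpos)))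
  have key : ∀ j, a (N + j) - δ / 2 ≤ c ^ j * |a N - δ / 2| := by
    intro j
    induction j with
    | zero => simpa using le_abs_self (a N - δ / 2)
    | succ j ih =>
      obtain ⟨h1, h2⟩ := hN (N + j) (by omega)
      have := mul_le_mul_of_nonneg_left ih hc0
      rw [pow_succ', ← add_assoc]
      nlinarith
  have hlim : Tendsto (fun j => c ^ j * |a N - δ / 2|) atTop (𝓝 0) := by
    simpa using (tendsto_pow_atTop_nhds_zero_of_lt_one hc0 hc1).mul_const |a N - δ / 2|
  obtain ⟨J, hJ⟩ := eventually_atTop.1 (hlim.eventually (gt_mem_nhds (half_pos hδ)))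
  refine ⟨N + J, fun k hk => ?_⟩
  obtain ⟨j, rfl⟩ := Nat.exists_eq_add_of_le (show N ≤ k by omega)
  have h1 := hJ j (by omega)
  have h2 := key j
  rw [Real.dist_eq, sub_zero, abs_of_nonneg (ha _)]
  linarith

/-- In finite dimension a linear map that strictly decreases the norm is a contraction. -/
theorem opNorm_lt_one_of_norm_apply_lt {Y : Type*} [NormedAddCommGroup Y] [NormedSpace ℝ Y]
    [FiniteDimensional ℝ Y] {T : Y →L[ℝ] Y} (h : ∀ y, y ≠ 0 → ‖T y‖ < ‖y‖) : ‖T‖ < 1 := by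
  have := FiniteDimensional.proper_real Y
  rcases subsingleton_or_nontrivial Y with hY | hY
  · have : T = 0 := by ext y; exact Subsingleton.elim _ _
    simp [this]
  · obtain ⟨y, hy, hmax⟩ := (isCompact_sphere (0 : Y) 1).exists_isMaxOn
      (NormedSpace.sphere_nonempty.2 zero_le_one) (T.continuous.norm.continuousOn)
    have hy1 : ‖y‖ = 1 := by simpa using hy
    refine lt_of_le_of_lt (T.opNorm_le_bound (norm_nonneg _) fun z => ?_)
      (hy1 ▸ h y (by rintro rfl; simp at hy1))
    rcases eq_or_ne z 0 with rfl | hz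
    · simp
    · have hz' : ‖z‖ ≠ 0 := norm_ne_zero_iff.2 hz
      have : ‖T (‖z‖⁻¹ • z)‖ ≤ ‖T y‖ := hmax (by simp [norm_smul, hz'])
      rw [map_smul, norm_smul, norm_inv, norm_norm] at this
      have h2 := mul_le_mul_of_nonneg_right this (norm_nonneg z)
      rwa [mul_right_comm, inv_mul_cancel₀ hz', one_mul] at h2

/-- Perturbed affine iterations of a strictly norm-decreasing linear map converge to a fixed point
of the limiting affine map. -/
theorem exists_tendsto_of_perturbed_contraction {Y : Type*} [NormedAddCommGroup Y]
    [NormedSpace ℝ Y] [FiniteDimensional ℝ Y] {T : Y →L[ℝ] Y} (h : ∀ y, y ≠ 0 → ‖T y‖ < ‖y‖)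
    {Tk : ℕ → Y →L[ℝ] Y} {t : Y} {tk y : ℕ → Y} (hT : Tendsto Tk atTop (𝓝 T))
    (ht : Tendsto tk atTop (𝓝 t)) (hy : ∀ᶠ k in atTop, y (k + 1) = Tk k (y k) + tk k) :
    ∃ z, Tendsto y atTop (𝓝 z) ∧ T z + t = z := by
  have hT1 := opNorm_lt_one_of_norm_apply_lt h
  have hinj : Function.Injective (1 - T : Y →L[ℝ] Y).toLinearMap := by
    rw [← LinearMap.ker_eq_bot, LinearMap.ker_eq_bot']
    intro w hw
    by_contra hne
    have hw' : w = T w := sub_eq_zero.1 (by simpa using hw)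
    have := h w hne
    rw [← hw'] at this
    exact lt_irrefl _ this
  obtain ⟨z, hz⟩ := LinearMap.injective_iff_surjective.1 hinj t
  have hz' : T z + t = z := by
    have : z - T z = t := by simpa using hz
    rw [← this]; abel
  refine ⟨z, ?_, hz'⟩
  rw [tendsto_iff_norm_sub_tendsto_zero]
  have hε : Tendsto (fun k => ‖Tk k z + tk k - z‖) atTop (𝓝 0) := by
    have : Tendsto (fun k => Tk k z + tk k) atTop (𝓝 z) := by
      simpa only [hz'] using (tendsto_clm_apply hT (tendsto_const_nhds (x := z))).add ht
    simpa using (this.sub_const z).norm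
  refine tendsto_zero_of_le_mul_add (c := (1 + ‖T‖) / 2) (by positivity) (by linarith)
    (fun _ => norm_nonneg _) hε ?_
  filter_upwards [hy, hT.norm.eventually (gt_mem_nhds (show ‖T‖ < (1 + ‖T‖) / 2 by linarith))]
    with k hk hk2
  have : y (k + 1) - z = Tk k (y k - z) + (Tk k z + tk k - z) := by
    rw [hk, map_sub]; abel
  rw [this]
  refine (norm_add_le _ _).trans (add_le_add_left ((Tk k).le_of_opNorm_le hk2.le _) _)

/-- Minimizing sequences of a convex function with a unique minimizer converge. -/
theorem tendsto_of_convexOn_unique_min {W : Type*} [NormedAddCommGroup W] [NormedSpace ℝ W]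
    [FiniteDimensional ℝ W] {C : Set W} (hC : IsClosed C) {Φ : W → ℝ} (hΦ : ConvexOn ℝ C Φ)
    (hcont : Continuous Φ) {a : W} (ha : a ∈ C) (ha0 : Φ a = 0)
    (huniq : ∀ w ∈ C, Φ w ≤ 0 → w = a) {w : ℕ → W} (hw : ∀ᶠ k in atTop, w k ∈ C)
    (hlim : Tendsto (fun k => Φ (w k)) atTop (𝓝 0)) : Tendsto w atTop (𝓝 a) := by
  have := FiniteDimensional.proper_real W
  rw [Metric.tendsto_nhds]
  intro ε hε
  have hpos : ∀ z ∈ C ∩ Metric.sphere a ε, 0 < Φ z := by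
    rintro z ⟨hz, hz2⟩
    by_contra hneg
    rw [huniq z hz (not_lt.1 hneg)] at hz2
    simp at hz2
    exact hε.ne hz2
  obtain ⟨δ, hδ, hδ2⟩ : ∃ δ > 0, ∀ z ∈ C ∩ Metric.sphere a ε, δ ≤ Φ z := by
    rcases (C ∩ Metric.sphere a ε).eq_empty_or_nonempty with h | h
    · exact ⟨1, one_pos, by simp [h]⟩
    · obtain ⟨z, hz, hmin⟩ := ((isCompact_sphere a ε).inter_left hC).exists_isMinOn h
        hcont.continuousOn
      exact ⟨Φ z, hpos z hz, fun z' hz' => hmin hz'⟩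
  filter_upwards [hw, hlim.eventually (gt_mem_nhds hδ)] with k hk hk2
  by_contra hge
  rw [dist_eq_norm, not_lt] at hge
  have hn : 0 < ‖w k - a‖ := hε.trans_le hge
  set r := ε / ‖w k - a‖
  have hr0 : 0 < r := div_pos hε hn
  have hr1 : r ≤ 1 := (div_le_one hn).2 hge
  have hmem := hΦ.1 ha hk (sub_nonneg.2 hr1) hr0.le (by ring)
  have hle := hΦ.2 ha hk (sub_nonneg.2 hr1) hr0.le (by ring)
  have hsph : (1 - r) • a + r • w k ∈ Metric.sphere a ε := by
    have : (1 - r) • a + r • w k - a = r • (w k - a) := by module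
    rw [mem_sphere_iff_norm, this, norm_smul, Real.norm_of_nonneg hr0.le]
    exact div_mul_cancel₀ _ hn.ne'
  have h3 := hδ2 _ ⟨hmem, hsph⟩
  simp only [ha0, smul_eq_mul, mul_zero, zero_add] at hle
  nlinarith

section affine

variable {V Y : Type*} [NormedAddCommGroup V] [InnerProductSpace ℝ V] [FiniteDimensional ℝ V]
  [NormedAddCommGroup Y] [InnerProductSpace ℝ Y] [FiniteDimensional ℝ Y]

/-- The energy identity behind the linear splitting iteration. -/
theorem norm_lt_of_linear_step {M : V →L[ℝ] Y} {H : V →L[ℝ] V} {Q : Y →L[ℝ] Y} {ρ : ℝ}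
    (hρ : 0 < ρ) (hH : ∀ x, 0 ≤ inner ℝ x (H x))
    (hQ : ∀ y z, inner ℝ (Q y) (z - Q z) = 0)
    (hinj : ∀ x y, H x + M.adjoint (Q y) = 0 → ρ • M x = y - Q y → x = 0 ∧ y = 0)
    {x : V} {y : Y} (hy : y ≠ 0)
    (hx : H x + M.adjoint ((2 : ℝ) • Q y - y + ρ • M x) = 0) : ‖Q y + ρ • M x‖ < ‖y‖ := by
  have h1 : inner ℝ (M x) ((2 : ℝ) • Q y - y + ρ • M x) = - inner ℝ x (H x) := by
    rw [← ContinuousLinearMap.adjoint_inner_right, eq_neg_of_add_eq_zero_right hx, inner_neg_right]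
  have h2 : inner ℝ (Q y + ρ • M x) (Q y + ρ • M x - y) = -(ρ * inner ℝ x (H x)) := by
    have h3 := hQ y y
    simp only [inner_add_left, inner_add_right, inner_sub_right, inner_smul_left, inner_smul_right,
      RCLike.conj_to_real] at h1 h3 ⊢
    rw [real_inner_comm (M x) (Q y)]
    rw [show inner ℝ x (H x) = -(2 * inner ℝ (M x) (Q y) - inner ℝ (M x) y
      + ρ * inner ℝ (M x) (M x)) by rw [h1]; ring]
    linear_combination -h3
  have h4 : ‖y‖ ^ 2 = ‖Q y + ρ • M x‖ ^ 2 + ‖Q y + ρ • M x - y‖ ^ 2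
      - 2 * inner ℝ (Q y + ρ • M x) (Q y + ρ • M x - y) := by
    have := norm_sub_sq_real (Q y + ρ • M x) (Q y + ρ • M x - y)
    rw [sub_sub_cancel] at this
    linarith
  have hpos : 0 < ‖Q y + ρ • M x - y‖ := by
    rw [norm_pos_iff]
    intro h0
    have h5 : ρ • M x = y - Q y := by
      rw [← sub_eq_zero, ← h0]; abel
    refine hy (hinj x y ?_ h5).2
    rw [← hx, h5]; congr 2; module
  have := mul_nonneg hρ.le (hH x)
  rw [h2] at h4
  exact lt_of_pow_lt_pow_left₀ 2 (norm_nonneg _) (by nlinarith)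

/-- Convergence of the perturbed splitting iteration for a quadratic program whose limiting
optimality system is nondegenerate. -/
theorem exists_tendsto_of_affine_splitting {M : V →L[ℝ] Y} {H : V →L[ℝ] V} {Q : Y →L[ℝ] Y} {ρ : ℝ}
    (hρ : 0 < ρ) (hH : ∀ x, 0 ≤ inner ℝ x (H x))
    (hQ : ∀ y z, inner ℝ (Q y) (z - Q z) = 0)
    (hinj : ∀ x y, H x + M.adjoint (Q y) = 0 → ρ • M x = y - Q y → x = 0 ∧ y = 0)
    {Hk : ℕ → V →L[ℝ] V} {ck x : ℕ → V} {ek y : ℕ → Y} {c : V} {e : Y}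
    (hHk : Tendsto Hk atTop (𝓝 H)) (hck : Tendsto ck atTop (𝓝 c)) (hek : Tendsto ek atTop (𝓝 e))
    (hx : ∀ᶠ k in atTop, Hk k (x (k + 1))
      + M.adjoint ((2 : ℝ) • Q (y k) - y k + ρ • (M (x (k + 1)) + ek k)) + ck k = 0)
    (hy : ∀ᶠ k in atTop, y (k + 1) = Q (y k) + ρ • (M (x (k + 1)) + ek k)) :
    ∃ x' y', Tendsto x atTop (𝓝 x') ∧ H x' + M.adjoint (Q y') + c = 0 ∧
      ρ • (M x' + e) = y' - Q y' := by
  set R : Y →L[ℝ] Y := (2 : ℝ) • Q - 1 with hR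
  set K : V →L[ℝ] V := H + ρ • (M.adjoint ∘L M) with hK
  set Kk : ℕ → V →L[ℝ] V := fun k => Hk k + ρ • (M.adjoint ∘L M) with hKk
  have hKinj : Function.Injective K.toLinearMap := by
    rw [← LinearMap.ker_eq_bot, LinearMap.ker_eq_bot']
    intro w hw
    have hw' : H w + ρ • M.adjoint (M w) = 0 := by simpa [hK] using hw
    have h1 : inner ℝ w (H w) + ρ * ‖M w‖ ^ 2 = 0 := by
      have := congrArg (inner ℝ w) hw'
      rwa [inner_add_right, inner_smul_right, ContinuousLinearMap.adjoint_inner_right,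
        real_inner_self_eq_norm_sq, inner_zero_right] at this
    have h2 : M w = 0 := by
      have h3 := hH w
      have : ‖M w‖ ^ 2 = 0 := by
        by_contra hne
        have : 0 < ‖M w‖ ^ 2 := lt_of_le_of_ne (sq_nonneg _) (Ne.symm hne)
        nlinarith
      simpa using this
    refine (hinj w 0 ?_ ?_).1
    · simpa [h2] using hw'
    · simp [h2]
  let Ke : V ≃L[ℝ] V := (LinearEquiv.ofInjectiveEndo K.toLinearMap hKinj).toContinuousLinearEquiv
  have hKe : (Ke : V →L[ℝ] V) = K := by ext w; rfl
  have hKinv : K.IsInvertible := ⟨Ke, hKe⟩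
  have hKk_lim : Tendsto Kk atTop (𝓝 K) := hHk.add_const _
  have hinv_lim : Tendsto (fun k => (Kk k).inverse) atTop (𝓝 K.inverse) := by
    have : ContinuousAt ContinuousLinearMap.inverse K := by
      rw [← hKe]; exact (contDiffAt_map_inverse (n := 0) Ke).continuousAt
    exact this.tendsto.comp hKk_lim
  have hKk_inv : ∀ᶠ k in atTop, (Kk k).IsInvertible := by
    have := hKk_lim.eventually (ContinuousLinearEquiv.nhds Ke |> fun h => by rwa [hKe] at h)
    filter_upwards [this] with k hk
    exact hk
  have hxk : ∀ᶠ k in atTop, x (k + 1) = -(Kk k).inverse (M.adjoint (R (y k) + ρ • ek k) + ck k) := by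
    filter_upwards [hx, hKk_inv] with k hk hki
    have : M.adjoint (R (y k) + ρ • ek k) + ck k = -(Kk k (x (k + 1))) := by
      rw [eq_neg_iff_add_eq_zero, ← hk]
      simp [hKk, hR, map_add, map_sub, map_smul]
      abel
    rw [this, map_neg, neg_neg]
    exact (hki.inverse_apply_self _).symm
  let F : (V →L[ℝ] V) → Y →L[ℝ] Y := fun B => Q - ρ • (M ∘L B ∘L M.adjoint ∘L R)
  have hF : Continuous F := by fun_prop
  obtain ⟨z, hz, hfix⟩ := exists_tendsto_of_perturbed_contraction (T := F K.inverse)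
    (Tk := fun k => F (Kk k).inverse) (y := y)
    (tk := fun k => ρ • (ek k - M ((Kk k).inverse (M.adjoint (ρ • ek k) + ck k))))
    (t := ρ • (e - M (K.inverse (M.adjoint (ρ • e) + c))))
    (by
      intro w hw
      have := norm_lt_of_linear_step hρ hH hQ hinj (x := -K.inverse (M.adjoint (R w))) hw (by
        have h1 : K (K.inverse (M.adjoint (R w))) = M.adjoint (R w) := hKinv.self_apply_inverse _
        rw [map_add, show (2 : ℝ) • Q w - w = R w by simp [hR]]
        nth_rw 2 [← h1]
        rw [hK, add_apply, ← hK]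
        simp)
      simpa [F, sub_eq_add_neg] using this)
    ((hF.tendsto _).comp hinv_lim)
    (by
      have h1 : Tendsto (fun k => M.adjoint (ρ • ek k) + ck k) atTop
          (𝓝 (M.adjoint (ρ • e) + c)) :=
        ((M.adjoint.continuous.tendsto _).comp (hek.const_smul ρ)).add hck
      have h2 := tendsto_clm_apply hinv_lim h1
      exact (hek.sub ((M.continuous.tendsto _).comp h2)).const_smul ρ)
    (by
      filter_upwards [hy, hxk] with k hk1 hk2
      rw [hk1, hk2]
      simp [F]
      module)
  refine ⟨-K.inverse (M.adjoint (R z + ρ • e) + c), z, ?_, ?_, ?_⟩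
  · rw [← tendsto_add_atTop_iff_nat 1]
    refine Tendsto.congr' (hxk.mono fun k hk => hk.symm) ?_
    have h1 : Tendsto (fun k => M.adjoint (R (y k) + ρ • ek k) + ck k) atTop
        (𝓝 (M.adjoint (R z + ρ • e) + c)) :=
      ((M.adjoint.continuous.tendsto _).comp
        (((R.continuous.tendsto _).comp hz).add (hek.const_smul ρ))).add hck
    exact (tendsto_clm_apply hinv_lim h1).neg
  all_goals
    set x' := -K.inverse (M.adjoint (R z + ρ • e) + c) with hx'
    have hfix' : ρ • (M x' + e) = z - Q z := by
      have : Q z + ρ • (M x' + e) = z := by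
        conv_rhs => rw [← hfix]
        simp [F, hx']
        module
      rw [eq_sub_iff_add_eq, add_comm, this]
  · have h1 : K x' = -(M.adjoint (R z + ρ • e) + c) := by
      rw [hx', map_neg, hKinv.self_apply_inverse]
    have h2 : K x' = H x' + M.adjoint (ρ • M x') := by simp [hK]
    have h3 : Q z = ρ • M x' + (R z + ρ • e) := by
      have : ρ • M x' = z - Q z - ρ • e := by rw [← hfix', smul_add]; abel
      rw [this]; simp [hR]; module
    rw [h3, map_add, ← add_assoc, ← h2, h1]; abel
  · exact hfix'

end affine

/-- Taking adjoints, as a continuous linear map over `ℝ`. -/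
noncomputable def adjointCLM (n r : ℕ) : (E n →L[ℝ] E r) →L[ℝ] (E r →L[ℝ] E n) :=
  LinearMap.toContinuousLinearMap
    { toFun := fun B => B.adjoint
      map_add' := fun B C => map_add _ B C
      map_smul' := fun a B => by simp }

@[simp] theorem adjointCLM_apply {n r : ℕ} (B : E n →L[ℝ] E r) :
    adjointCLM n r B = B.adjoint := rfl

theorem hasFDerivAt_adjoint_apply {n r : ℕ} {W : Type*} [NormedAddCommGroup W] [NormedSpace ℝ W]
    {B : W → E n →L[ℝ] E r} {B' : W →L[ℝ] E n →L[ℝ] E r} {u : W → E r} {u' : W →L[ℝ] E r} {w : W}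
    (hB : HasFDerivAt B B' w) (hu : HasFDerivAt u u' w) :
    HasFDerivAt (fun w => (B w).adjoint (u w))
      ((B w).adjoint.comp u' + ((adjointCLM n r).comp B').flip (u w)) w :=
  ((adjointCLM n r).hasFDerivAt.comp w hB).clm_apply hu

/-- The product rule for the entrywise product. -/
theorem hasFDerivAt_toLp_mul {q : ℕ} {W : Type*} [NormedAddCommGroup W] [NormedSpace ℝ W]
    {a b : W → E q} {a' b' : W →L[ℝ] E q} {w : W} (ha : HasFDerivAt a a' w)
    (hb : HasFDerivAt b b' w) :
    ∃ D : W →L[ℝ] E q, HasFDerivAt (fun w => (WithLp.toLp 2 fun i => a w i * b w i : E q)) D w ∧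
      ∀ v, D v = WithLp.toLp 2 fun i => a w i * b' v i + a' v i * b w i := by
  have hi : ∀ i, HasFDerivAt (fun w => a w i * b w i) _ w := fun i =>
    ((PiLp.proj 2 (fun _ : Fin q => ℝ) i : E q →L[ℝ] ℝ).hasFDerivAt.comp w ha).mul
      ((PiLp.proj 2 (fun _ : Fin q => ℝ) i : E q →L[ℝ] ℝ).hasFDerivAt.comp w hb)
  refine ⟨_, (PiLp.continuousLinearEquiv 2 ℝ (fun _ : Fin q => ℝ)).symm.hasFDerivAt.comp w
    (hasFDerivAt_pi.2 hi), fun v => ?_⟩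
  ext i
  simp [mul_comm]

namespace Program

variable {m n p q : ℕ} (P : Program m n p q) (ρ : ℝ)

/-- The convexity and smoothness assumptions on the program near the parameter `θ`. -/
structure IsRegularAt (U : Set (E m)) (θ : E m) : Prop where
  mem_nhds : U ∈ 𝓝 θ
  convex : ConvexOn ℝ Set.univ (P.f θ)
  differentiable : ∀ θ' ∈ U, Differentiable ℝ (P.f θ')
  grad : ∀ x, ContDiffAt ℝ 1 (fun w : E m × E n => gradient (P.f w.1) w.2) (θ, x)
  A : DifferentiableAt ℝ P.A θ
  b : DifferentiableAt ℝ P.b θ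
  G : DifferentiableAt ℝ P.G θ
  h : DifferentiableAt ℝ P.h θ

/-- The derivative of `(θ, x) ↦ ∇_x f(x; θ)`. -/
noncomputable def gradDeriv (θ : E m) (x : E n) : E m × E n →L[ℝ] E n :=
  fderiv ℝ (fun w : E m × E n => gradient (P.f w.1) w.2) (θ, x)

/-- The Hessian `∇_x^2 f(x; θ)`. -/
noncomputable def hess (θ : E m) (x : E n) : E n →L[ℝ] E n :=
  (P.gradDeriv θ x).comp (ContinuousLinearMap.inr ℝ (E m) (E n))

variable {P} {U : Set (E m)} {θ : E m}

namespace IsRegularAt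

theorem mem (hP : P.IsRegularAt U θ) : θ ∈ U := mem_of_mem_nhds hP.mem_nhds

theorem hasFDerivAt_grad (hP : P.IsRegularAt U θ) (x : E n) :
    HasFDerivAt (fun w : E m × E n => gradient (P.f w.1) w.2) (P.gradDeriv θ x) (θ, x) :=
  ((hP.grad x).differentiableAt one_ne_zero).hasFDerivAt

theorem hasFDerivAt_gradient (hP : P.IsRegularAt U θ) (x : E n) :
    HasFDerivAt (gradient (P.f θ)) (P.hess θ x) x :=
  (hP.hasFDerivAt_grad x).comp x (hasFDerivAt_prodMk_right θ x)

theorem continuous_gradDeriv (hP : P.IsRegularAt U θ) : Continuous (P.gradDeriv θ) := by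
  rw [continuous_iff_continuousAt]
  intro x
  have h1 : ContinuousAt (fderiv ℝ (fun w : E m × E n => gradient (P.f w.1) w.2)) (θ, x) :=
    ((hP.grad x).fderiv_right (m := 0) (by norm_num)).continuousAt
  exact h1.comp (f := fun y : E n => (θ, y)) (by fun_prop)

theorem continuous_hess (hP : P.IsRegularAt U θ) : Continuous (P.hess θ) :=
  hP.continuous_gradDeriv.clm_comp continuous_const

theorem continuous_gradient (hP : P.IsRegularAt U θ) : Continuous (gradient (P.f θ)) :=
  continuous_iff_continuousAt.2 fun x => (hP.hasFDerivAt_gradient x).continuousAt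

theorem hasGradientAt (hP : P.IsRegularAt U θ) {θ' : E m} (hθ' : θ' ∈ U) (x : E n) :
    HasGradientAt (P.f θ') (gradient (P.f θ') x) x :=
  (hP.differentiable θ' hθ' x).hasGradientAt

theorem hasGradientAt_augLag (hP : P.IsRegularAt U θ) {θ' : E m} (hθ' : θ' ∈ U) (x : E n)
    (s : E q) (lam : E p) (nu : E q) :
    HasGradientAt (fun y => P.augLag ρ θ' y s lam nu)
      (gradient (P.f θ') x + (P.A θ').adjoint (lam + ρ • (P.A θ' x - P.b θ'))
        + (P.G θ').adjoint (nu + ρ • (P.G θ' x + s - P.h θ'))) x := by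
  have h1 := (hP.hasGradientAt hθ' x).hasFDerivAt
  have hA : HasFDerivAt (fun y => P.A θ' y - P.b θ') (P.A θ') x :=
    (P.A θ').hasFDerivAt.sub_const _
  have hG : HasFDerivAt (fun y => P.G θ' y + s - P.h θ') (P.G θ') x :=
    ((P.G θ').hasFDerivAt.add_const _).sub_const _
  have h2 := (hasFDerivAt_const lam x).inner ℝ hA
  have h3 := (hasFDerivAt_const nu x).inner ℝ hG
  have h4 := ((hA.norm_sq).add (hG.norm_sq)).const_mul (ρ / 2)
  rw [hasGradientAt_iff_hasFDerivAt]
  refine (((h1.add h2).add h3).add h4).congr_fderiv ?_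
  ext v
  simp [ContinuousLinearMap.adjoint_inner_left, fderivInnerCLM_apply]
  ring

theorem gradL_eq (hP : P.IsRegularAt U θ) {θ' : E m} (hθ' : θ' ∈ U) (x : E n)
    (s : E q) (lam : E p) (nu : E q) :
    P.gradL ρ θ' x s lam nu =
      gradient (P.f θ') x + (P.A θ').adjoint (lam + ρ • (P.A θ' x - P.b θ'))
        + (P.G θ').adjoint (nu + ρ • (P.G θ' x + s - P.h θ')) :=
  (hP.hasGradientAt_augLag ρ hθ' x s lam nu).gradient

theorem hessL_apply (hP : P.IsRegularAt U θ) (x : E n) (s : E q) (lam : E p) (nu : E q)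
    (v : E n) : P.hessL ρ θ x s lam nu v =
      P.hess θ x v + (P.A θ).adjoint (ρ • P.A θ v) + (P.G θ).adjoint (ρ • P.G θ v) := by
  have hA : HasFDerivAt (fun y => lam + ρ • (P.A θ y - P.b θ)) (ρ • P.A θ) x :=
    (((P.A θ).hasFDerivAt.sub_const _).const_smul ρ).const_add _
  have hG : HasFDerivAt (fun y => nu + ρ • (P.G θ y + s - P.h θ)) (ρ • P.G θ) x :=
    ((((P.G θ).hasFDerivAt.add_const _).sub_const _).const_smul ρ).const_add _
  have h1 := ((hP.hasFDerivAt_gradient x).add ((P.A θ).adjoint.hasFDerivAt.comp x hA)).add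
    ((P.G θ).adjoint.hasFDerivAt.comp x hG)
  have h2 : (fun y => P.gradL ρ θ y s lam nu) = _ := funext fun y => hP.gradL_eq ρ hP.mem y s lam nu
  have h3 : HasFDerivAt (fun y => P.gradL ρ θ y s lam nu) _ x :=
    h1.congr_of_eventuallyEq (Eventually.of_forall (congrFun h2))
  rw [hessL, h3.fderiv]
  simp

theorem eqJac_apply (hP : P.IsRegularAt U θ) (x : E n) (X : E m →L[ℝ] E n) (v : E m) :
    P.eqJac θ x X v = P.A θ (X v) + fderiv ℝ P.A θ v x - fderiv ℝ P.b θ v := by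
  have hfst : HasFDerivAt (fun w : E m × E n => w.1) _ (θ, x) := hasFDerivAt_fst (𝕜 := ℝ)
  have hA : HasFDerivAt (fun w : E m × E n => P.A w.1) _ (θ, x) :=
    hP.A.hasFDerivAt.comp (θ, x) hfst
  have h1 : HasFDerivAt (fun w : E m × E n => P.A w.1 w.2 - P.b w.1) _ (θ, x) :=
    (hA.clm_apply hasFDerivAt_snd).sub (hP.b.hasFDerivAt.comp (θ, x) hfst)
  rw [eqJac, totalJac, h1.fderiv]
  simp

theorem ineqJac_apply (hP : P.IsRegularAt U θ) (x : E n) (X : E m →L[ℝ] E n) (v : E m) :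
    P.ineqJac θ x X v = P.G θ (X v) + fderiv ℝ P.G θ v x - fderiv ℝ P.h θ v := by
  have hfst : HasFDerivAt (fun w : E m × E n => w.1) _ (θ, x) := hasFDerivAt_fst (𝕜 := ℝ)
  have hG : HasFDerivAt (fun w : E m × E n => P.G w.1) _ (θ, x) :=
    hP.G.hasFDerivAt.comp (θ, x) hfst
  have h1 : HasFDerivAt (fun w : E m × E n => P.G w.1 w.2 - P.h w.1) _ (θ, x) :=
    (hG.clm_apply hasFDerivAt_snd).sub (hP.h.hasFDerivAt.comp (θ, x) hfst)
  rw [ineqJac, totalJac, h1.fderiv]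
  simp

theorem slackJac_apply (hP : P.IsRegularAt U θ) (x : E n) (s : E q) (X : E m →L[ℝ] E n)
    (S : E m →L[ℝ] E q) (v : E m) :
    P.slackJac θ x s X S v = P.G θ (X v) + fderiv ℝ P.G θ v x + S v - fderiv ℝ P.h θ v := by
  have h2 : HasFDerivAt (fun w : E m × E n × E q => w.2) _ (θ, x, s) := hasFDerivAt_snd (𝕜 := ℝ)
  have hfst : HasFDerivAt (fun w : E m × E n × E q => w.1) _ (θ, x, s) := hasFDerivAt_fst (𝕜 := ℝ)
  have hG : HasFDerivAt (fun w : E m × E n × E q => P.G w.1) _ (θ, x, s) :=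
    hP.G.hasFDerivAt.comp (θ, x, s) hfst
  have h1 : HasFDerivAt (fun w : E m × E n × E q => P.G w.1 w.2.1 + w.2.2 - P.h w.1) _ (θ, x, s) :=
    ((hG.clm_apply h2.fst).add h2.snd).sub (hP.h.hasFDerivAt.comp (θ, x, s) hfst)
  rw [slackJac, totalJac, h1.fderiv]
  simp

theorem mixedL_apply (hP : P.IsRegularAt U θ) (x : E n) (s : E q) (lam : E p) (nu : E q)
    (S : E m →L[ℝ] E q) (Lam : E m →L[ℝ] E p) (Nu : E m →L[ℝ] E q) (v : E m) :
    P.mixedL ρ θ x s lam nu S Lam Nu v =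
      P.gradDeriv θ x (v, 0)
        + ((fderiv ℝ P.A θ v).adjoint (lam + ρ • (P.A θ x - P.b θ))
          + (P.A θ).adjoint (Lam v + ρ • (fderiv ℝ P.A θ v x - fderiv ℝ P.b θ v)))
        + ((fderiv ℝ P.G θ v).adjoint (nu + ρ • (P.G θ x + s - P.h θ))
          + (P.G θ).adjoint (Nu v + ρ • (fderiv ℝ P.G θ v x + S v - fderiv ℝ P.h θ v))) := by
  set w₀ : E m × E q × E p × E q := (θ, s, lam, nu) with hw₀
  have hfst : HasFDerivAt (fun w : E m × E q × E p × E q => w.1) _ w₀ := hasFDerivAt_fst (𝕜 := ℝ)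
  have hsnd : HasFDerivAt (fun w : E m × E q × E p × E q => w.2) _ w₀ := hasFDerivAt_snd (𝕜 := ℝ)
  have hg : HasFDerivAt (fun w : E m × E q × E p × E q => gradient (P.f w.1) x) _ w₀ :=
    HasFDerivAt.comp (f := fun w : E m × E q × E p × E q => (w.1, x)) w₀ (hP.hasFDerivAt_grad x)
      (hfst.prodMk (hasFDerivAt_const x w₀))
  have hA : HasFDerivAt (fun w : E m × E q × E p × E q => P.A w.1) _ w₀ :=
    hP.A.hasFDerivAt.comp w₀ hfst
  have hb : HasFDerivAt (fun w : E m × E q × E p × E q => P.b w.1) _ w₀ :=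
    hP.b.hasFDerivAt.comp w₀ hfst
  have hG : HasFDerivAt (fun w : E m × E q × E p × E q => P.G w.1) _ w₀ :=
    hP.G.hasFDerivAt.comp w₀ hfst
  have hh : HasFDerivAt (fun w : E m × E q × E p × E q => P.h w.1) _ w₀ :=
    hP.h.hasFDerivAt.comp w₀ hfst
  have hAx := hA.clm_apply (hasFDerivAt_const x w₀)
  have hGx := hG.clm_apply (hasFDerivAt_const x w₀)
  have h1 := (hg.add (hasFDerivAt_adjoint_apply hA
      (hsnd.snd.fst.add ((hAx.sub hb).const_smul ρ)))).add
    (hasFDerivAt_adjoint_apply hG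
      (hsnd.snd.snd.add (((hGx.add hsnd.fst).sub hh).const_smul ρ)))
  have h2 : (fun w : E m × E q × E p × E q => P.gradL ρ w.1 x w.2.1 w.2.2.1 w.2.2.2) =ᶠ[𝓝 w₀] _ :=
    (continuous_fst.continuousAt.eventually_mem (x := w₀) hP.mem_nhds).mono fun w hw =>
      hP.gradL_eq ρ hw x w.2.1 w.2.2.1 w.2.2.2
  have h3 : HasFDerivAt (fun w : E m × E q × E p × E q =>
    P.gradL ρ w.1 x w.2.1 w.2.2.1 w.2.2.2) _ w₀ := h1.congr_of_eventuallyEq h2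
  rw [mixedL, totalJac, h3.fderiv]
  simp [hw₀]
  abel

theorem kktJac_apply (hP : P.IsRegularAt U θ) (x : E n) (lam : E p) (nu : E q)
    (dx : E n) (dl : E p) (dn : E q) :
    P.kktJac θ (x, lam, nu) (dx, dl, dn) =
      (P.hess θ x dx + (P.A θ).adjoint dl + (P.G θ).adjoint dn, P.A θ dx,
        WithLp.toLp 2 fun i => nu i * P.G θ dx i + dn i * (P.G θ x - P.h θ) i) := by
  set z₀ : E n × E p × E q := (x, lam, nu) with hz₀
  have hfst : HasFDerivAt (fun z : E n × E p × E q => z.1) _ z₀ := hasFDerivAt_fst (𝕜 := ℝ)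
  have hsnd : HasFDerivAt (fun z : E n × E p × E q => z.2) _ z₀ := hasFDerivAt_snd (𝕜 := ℝ)
  have h1 := (((hP.hasFDerivAt_gradient x).comp z₀ hfst).add
    ((P.A θ).adjoint.hasFDerivAt.comp z₀ hsnd.fst)).add ((P.G θ).adjoint.hasFDerivAt.comp z₀ hsnd.snd)
  have h2 := ((P.A θ).hasFDerivAt.comp z₀ hfst).sub_const (P.b θ)
  have hG := ((P.G θ).hasFDerivAt.comp z₀ hfst).sub_const (P.h θ)
  obtain ⟨D, h3, hD⟩ := hasFDerivAt_toLp_mul hsnd.snd hG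
  have h4 : HasFDerivAt (fun z => P.kktMap θ z) _ z₀ := h1.prodMk (h2.prodMk h3)
  rw [kktJac, h4.fderiv]
  simp [hz₀, hD]

theorem kktJacParam_apply (hP : P.IsRegularAt U θ) (x : E n) (lam : E p) (nu : E q) (v : E m) :
    P.kktJacParam θ (x, lam, nu) v =
      (P.gradDeriv θ x (v, 0) + (fderiv ℝ P.A θ v).adjoint lam + (fderiv ℝ P.G θ v).adjoint nu,
        fderiv ℝ P.A θ v x - fderiv ℝ P.b θ v,
        WithLp.toLp 2 fun i => nu i * (fderiv ℝ P.G θ v x - fderiv ℝ P.h θ v) i) := by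
  have hg : HasFDerivAt (fun t => gradient (P.f t) x) _ θ :=
    HasFDerivAt.comp (f := fun t => (t, x)) θ (hP.hasFDerivAt_grad x) (hasFDerivAt_prodMk_left θ x)
  have h1 := (hg.add (hasFDerivAt_adjoint_apply hP.A.hasFDerivAt (hasFDerivAt_const lam θ))).add
    (hasFDerivAt_adjoint_apply hP.G.hasFDerivAt (hasFDerivAt_const nu θ))
  have h2 := (hP.A.hasFDerivAt.clm_apply (hasFDerivAt_const x θ)).sub hP.b.hasFDerivAt
  have hG := (hP.G.hasFDerivAt.clm_apply (hasFDerivAt_const x θ)).sub hP.h.hasFDerivAt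
  obtain ⟨D, h3, hD⟩ := hasFDerivAt_toLp_mul (hasFDerivAt_const nu θ) hG
  have h4 : HasFDerivAt (fun t => P.kktMap t (x, lam, nu)) _ θ := h1.prodMk (h2.prodMk h3)
  rw [kktJacParam, h4.fderiv]
  simp [hD]

end IsRegularAt

end Program

/-- First-order characterization of convexity. -/
theorem inner_gradient_le_sub {V : Type*} [NormedAddCommGroup V] [InnerProductSpace ℝ V]
    [CompleteSpace V] {φ : V → ℝ} (hφ : ConvexOn ℝ Set.univ φ) {x g : V}
    (hg : HasGradientAt φ g x) (y : V) : inner ℝ g (y - x) ≤ φ y - φ x := by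
  have h1 : ConvexOn ℝ Set.univ (φ ∘ (AffineMap.lineMap x y : ℝ →ᵃ[ℝ] V)) :=
    hφ.comp_affineMap _
  have h2 : HasDerivAt (φ ∘ (AffineMap.lineMap x y : ℝ →ᵃ[ℝ] V)) (inner ℝ g (y - x)) 0 := by
    have h3 : HasFDerivAt φ (InnerProductSpace.toDual ℝ V g)
        ((AffineMap.lineMap x y : ℝ →ᵃ[ℝ] V) 0) := by
      simpa using hg.hasFDerivAt
    exact h3.comp_hasDerivAt (0 : ℝ) AffineMap.hasDerivAt_lineMap
  have := h1.le_slope_of_hasDerivAt (Set.mem_univ _) (Set.mem_univ 1) zero_lt_one h2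
  simpa [slope_def_field] using this

theorem convexOn_norm_sq_affine {W Z : Type*} [NormedAddCommGroup W] [NormedSpace ℝ W]
    [NormedAddCommGroup Z] [NormedSpace ℝ Z] (L : W →L[ℝ] Z) (z : Z) :
    ConvexOn ℝ Set.univ fun w => ‖L w - z‖ ^ 2 := by
  have h := ((convexOn_univ_norm (E := Z)).pow (fun _ _ => norm_nonneg _) 2).comp_affineMap
    (L.toLinearMap.toAffineMap - AffineMap.const ℝ W z)
  simpa [Function.comp_def] using h

theorem convexOn_inner_affine {W Z : Type*} [NormedAddCommGroup W] [NormedSpace ℝ W]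
    [NormedAddCommGroup Z] [InnerProductSpace ℝ Z] (l : Z) (L : W →L[ℝ] Z) (z : Z) :
    ConvexOn ℝ Set.univ fun w => inner ℝ l (L w - z) := by
  have h := (((innerSL ℝ l).comp L).toLinearMap.convexOn convex_univ).add_const (-inner ℝ l z)
  refine h.congr fun w _ => ?_
  simp [inner_sub_right, ← sub_eq_add_neg]

/-- The energy identity of one step of the splitting method. -/
theorem splitting_energy {Y₁ Y₂ : Type*} [NormedAddCommGroup Y₁] [InnerProductSpace ℝ Y₁]
    [NormedAddCommGroup Y₂] [InnerProductSpace ℝ Y₂] {ρ D : ℝ} {l l' a : Y₁} {u u' ν σ g : Y₂}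
    (hu : u = ν - σ) (ha : l' = l + ρ • a) (hg : u' = ν + ρ • g)
    (hD : D + inner ℝ l' a + inner ℝ (u' + σ) g = 0) :
    ‖l'‖ ^ 2 + ‖u'‖ ^ 2 = ‖l‖ ^ 2 + ‖u‖ ^ 2 - ‖l' - l‖ ^ 2 - ‖u' - u‖ ^ 2
      + 2 * (inner ℝ σ ν - ρ * D) := by
  have hD' : D = -(inner ℝ l' a + inner ℝ (u' + σ) g) := by linarith
  rw [hD']
  subst ha hg hu
  simp only [← real_inner_self_eq_norm_sq]
  simp only [inner_add_left, inner_add_right, inner_sub_left, inner_sub_right, inner_smul_left,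
    inner_smul_right, RCLike.conj_to_real, real_inner_comm]
  ring

namespace Program

variable {m n p q : ℕ} {P : Program m n p q} {ρ : ℝ} {U : Set (E m)} {θ : E m}

namespace IsKKT

variable {xs : E n} {lams : E p} {nus : E q}

theorem stationary (h : P.IsKKT θ xs lams nus) :
    gradient (P.f θ) xs + (P.A θ).adjoint lams + (P.G θ).adjoint nus = 0 :=
  congrArg Prod.fst h.zero

theorem eq_constraint (h : P.IsKKT θ xs lams nus) : P.A θ xs = P.b θ :=
  sub_eq_zero.1 (congrArg (fun z => z.2.1) h.zero)

theorem complementary (h : P.IsKKT θ xs lams nus) (i : Fin q) :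
    nus i * (P.G θ xs - P.h θ) i = 0 :=
  congrArg (fun z => z.2.2 i) h.zero

theorem convexOn_lagrangian (hP : P.IsRegularAt U θ) (lams : E p) (nus : E q) :
    ConvexOn ℝ Set.univ fun y => P.augLag 0 θ y 0 lams nus := by
  refine ((hP.convex.add (convexOn_inner_affine lams (P.A θ) (P.b θ))).add
    (convexOn_inner_affine nus (P.G θ) (P.h θ))).congr fun y _ => ?_
  simp [augLag]

theorem hasGradientAt_lagrangian (h : P.IsKKT θ xs lams nus) (hP : P.IsRegularAt U θ) (y : E n) :
    HasGradientAt (fun y => P.augLag 0 θ y 0 lams nus)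
      (gradient (P.f θ) y - gradient (P.f θ) xs) y := by
  have h1 := hP.hasGradientAt_augLag 0 hP.mem y 0 lams nus
  have h2 := h.stationary
  convert h1 using 1
  rw [add_assoc] at h2
  rw [zero_smul, zero_smul, add_zero, add_zero, eq_neg_of_add_eq_zero_left h2]
  abel

theorem inner_nus (h : P.IsKKT θ xs lams nus) : inner ℝ nus (P.G θ xs - P.h θ) = 0 := by
  rw [PiLp.inner_apply]
  exact Finset.sum_eq_zero fun i _ => by simpa [mul_comm] using h.complementary i

theorem lagrangian_self (h : P.IsKKT θ xs lams nus) : P.augLag 0 θ xs 0 lams nus = P.f θ xs := by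
  simp [augLag, h.eq_constraint, h.inner_nus]

theorem le_lagrangian (h : P.IsKKT θ xs lams nus) (hP : P.IsRegularAt U θ) (y : E n) :
    P.f θ xs ≤ P.augLag 0 θ y 0 lams nus := by
  have := inner_gradient_le_sub (convexOn_lagrangian hP lams nus) (h.hasGradientAt_lagrangian hP xs) y
  rw [sub_self, inner_zero_left, h.lagrangian_self] at this
  linarith

/-- The merit function separates into the Lagrangian gap, the complementarity gap and the
squared residuals. -/
theorem augLag_two (y : E n) (s : E q) :
    P.augLag 2 θ y s lams nus = P.augLag 0 θ y 0 lams nus + inner ℝ nus s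
      + ‖P.A θ y - P.b θ‖ ^ 2 + ‖P.G θ y + s - P.h θ‖ ^ 2 := by
  simp only [augLag, inner_add_right, inner_sub_right, inner_zero_right]
  ring

theorem inner_nus_nonneg (h : P.IsKKT θ xs lams nus) {s : E q} (hs : ∀ i, 0 ≤ s i) :
    0 ≤ inner ℝ nus s := by
  rw [PiLp.inner_apply]
  exact Finset.sum_nonneg fun i _ => mul_nonneg (hs i) (h.dual_nonneg i)

theorem hess_eq_zero_of_lagrangian_eq (h : P.IsKKT θ xs lams nus) (hP : P.IsRegularAt U θ) {y : E n}
    (hy : P.augLag 0 θ y 0 lams nus = P.f θ xs) : P.hess θ xs (y - xs) = 0 := by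
  have hseg : ∀ t ∈ Set.Icc (0 : ℝ) 1,
      gradient (P.f θ) (AffineMap.lineMap xs y t) = gradient (P.f θ) xs := by
    intro t ht
    set z := AffineMap.lineMap xs y t with hz
    have h1 : P.augLag 0 θ z 0 lams nus ≤ P.f θ xs := by
      have := (convexOn_lagrangian hP lams nus).2 (Set.mem_univ xs) (Set.mem_univ y)
        (sub_nonneg.2 ht.2) ht.1 (by ring)
      rw [← AffineMap.lineMap_apply_module] at this
      refine this.trans (le_of_eq ?_)
      simp only [hy, h.lagrangian_self, smul_eq_mul]
      ring
    have hmin : IsLocalMin (fun y => P.augLag 0 θ y 0 lams nus) z :=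
      Eventually.of_forall fun w => h1.trans (h.le_lagrangian hP w)
    have := hmin.hasFDerivAt_eq_zero (h.hasGradientAt_lagrangian hP z).hasFDerivAt
    rw [map_eq_zero_iff _ (InnerProductSpace.toDual ℝ (E n)).injective] at this
    exact sub_eq_zero.1 this
  have hd : HasDerivAt (gradient (P.f θ) ∘ (AffineMap.lineMap xs y : ℝ →ᵃ[ℝ] E n))
      (P.hess θ xs (y - xs)) 0 := by
    have h3 : HasFDerivAt (gradient (P.f θ)) (P.hess θ xs)
        ((AffineMap.lineMap xs y : ℝ →ᵃ[ℝ] E n) 0) := by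
      simpa using hP.hasFDerivAt_gradient xs
    exact h3.comp_hasDerivAt (0 : ℝ) AffineMap.hasDerivAt_lineMap
  have hc : HasDerivWithinAt (gradient (P.f θ) ∘ (AffineMap.lineMap xs y : ℝ →ᵃ[ℝ] E n)) 0
      (Set.Icc 0 1) 0 :=
    (hasDerivWithinAt_const (0 : ℝ) (Set.Icc (0 : ℝ) 1) (gradient (P.f θ) xs)).congr hseg
      (hseg 0 (by simp))
  exact (uniqueDiffOn_Icc zero_lt_one 0 (by simp)).eq_deriv _ hd.hasDerivWithinAt hc

/-- Under invertibility of the KKT Jacobian the optimal pair of primal variable and slack is the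
unique minimizer of the merit function. -/
theorem eq_of_augLag_le (h : P.IsKKT θ xs lams nus) (hP : P.IsRegularAt U θ)
    (hinv : (P.kktJac θ (xs, lams, nus)).IsInvertible) {y : E n} {s : E q} (hs : ∀ i, 0 ≤ s i)
    (hle : P.augLag 2 θ y s lams nus ≤ P.f θ xs) : y = xs ∧ s = P.h θ - P.G θ xs := by
  have h1 := h.le_lagrangian hP y
  have h2 := h.inner_nus_nonneg hs
  rw [augLag_two] at hle
  have h3 := sq_nonneg ‖P.A θ y - P.b θ‖
  have h4 := sq_nonneg ‖P.G θ y + s - P.h θ‖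
  have h5 : P.A θ y - P.b θ = 0 := by
    have : ‖P.A θ y - P.b θ‖ ^ 2 = 0 := by linarith
    simpa using this
  have h6 : P.G θ y + s - P.h θ = 0 := by
    have : ‖P.G θ y + s - P.h θ‖ ^ 2 = 0 := by linarith
    simpa using this
  have h7 : ∀ i, s i * nus i = 0 := by
    have h8 : ∑ i, s i * nus i = 0 := by
      have : inner ℝ nus s = 0 := by linarith
      rw [PiLp.inner_apply] at this
      exact this
    exact fun i => (Finset.sum_eq_zero_iff_of_nonneg
      fun i _ => mul_nonneg (hs i) (h.dual_nonneg i)).1 h8 i (Finset.mem_univ i)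
  have hy : y = xs := by
    have hJ : P.kktJac θ (xs, lams, nus) (y - xs, 0, 0) = 0 := by
      rw [hP.kktJac_apply, h.hess_eq_zero_of_lagrangian_eq hP (by linarith)]
      refine Prod.ext (by simp) (Prod.ext ?_ ?_)
      · simp [h.eq_constraint, h5]
      · ext i
        have h9 := congrArg (fun z : E q => z i) h6
        have h10 := h.complementary i
        have h11 := h7 i
        simp at h9 h10 ⊢
        rcases h10 with h10 | h10
        · exact Or.inl h10
        · rcases mul_eq_zero.1 h11 with h11 | h11
          · right; linarith
          · exact Or.inl h11
    have := hinv.injective (hJ.trans (map_zero _).symm)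
    exact sub_eq_zero.1 (congrArg Prod.fst this)
  refine ⟨hy, ?_⟩
  rw [hy] at h6
  rw [eq_sub_iff_add_eq, add_comm]
  exact sub_eq_zero.1 h6

theorem strict_complementary (hP : P.IsRegularAt U θ)
    (hinv : (P.kktJac θ (xs, lams, nus)).IsInvertible) (i : Fin q)
    (hi : (P.G θ xs - P.h θ) i = 0) : nus i ≠ 0 := by
  intro h0
  obtain ⟨⟨dx, dl, dn⟩, hz⟩ := hinv.surjective (0, 0, EuclideanSpace.single i 1)
  rw [hP.kktJac_apply] at hz
  have := congrArg (fun z => z.2.2 i) hz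
  simp [h0] at this
  simp at hi
  simp [hi] at this

theorem tendsto_of_augLag (h : P.IsKKT θ xs lams nus) (hP : P.IsRegularAt U θ)
    (hinv : (P.kktJac θ (xs, lams, nus)).IsInvertible) {y : ℕ → E n} {s : ℕ → E q}
    (hs : ∀ᶠ k in atTop, ∀ i, 0 ≤ s k i)
    (hlim : Tendsto (fun k => P.augLag 2 θ (y k) (s k) lams nus) atTop (𝓝 (P.f θ xs))) :
    Tendsto y atTop (𝓝 xs) ∧ Tendsto s atTop (𝓝 (P.h θ - P.G θ xs)) := by
  have hcont : Continuous (P.f θ) := (hP.differentiable θ hP.mem).continuous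
  have key : Tendsto (fun k => (y k, s k)) atTop (𝓝 (xs, P.h θ - P.G θ xs)) := by
    refine tendsto_of_convexOn_unique_min (C := {w : E n × E q | ∀ i, 0 ≤ w.2 i})
      (Φ := fun w => P.augLag 2 θ w.1 w.2 lams nus - P.f θ xs) ?_ ?_ ?_ ?_ ?_ ?_ hs ?_
    · simp only [Set.ofPred_forall]
      exact isClosed_iInter fun i => isClosed_le continuous_const (by fun_prop)
    · have hC : Convex ℝ {w : E n × E q | ∀ i, 0 ≤ w.2 i} := by
        intro a ha b hb r t hr ht _ i
        have := add_nonneg (mul_nonneg hr (ha i)) (mul_nonneg ht (hb i))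
        simpa using this
      let LA : E n × E q →L[ℝ] E p := (P.A θ).comp (ContinuousLinearMap.fst ℝ _ _)
      let LG : E n × E q →L[ℝ] E q :=
        (P.G θ).comp (ContinuousLinearMap.fst ℝ _ _) + ContinuousLinearMap.snd ℝ _ _
      have h1 := (((((hP.convex.comp_linearMap (LinearMap.fst ℝ (E n) (E q))).add
        (convexOn_inner_affine lams LA (P.b θ))).add
        (convexOn_inner_affine nus LG (P.h θ))).add
        ((convexOn_norm_sq_affine LA (P.b θ)).add (convexOn_norm_sq_affine LG (P.h θ)))).add_const
        (-P.f θ xs)).subset (Set.subset_univ _) hC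
      refine h1.congr fun w _ => ?_
      simp [augLag, LA, LG, sub_eq_add_neg]
    · simp only [augLag]
      fun_prop
    · intro i
      have := h.primal_feasible i
      simpa using this
    · simp [augLag_two, h.lagrangian_self, h.eq_constraint, inner_sub_right]
      have := h.inner_nus
      rw [inner_sub_right] at this
      linarith
    · rintro ⟨y', s'⟩ hw hle
      obtain ⟨h1, h2⟩ := h.eq_of_augLag_le hP hinv hw (sub_nonpos.1 hle)
      exact Prod.ext h1 h2
    · simpa using hlim.sub_const (P.f θ xs)
  exact ⟨(continuous_fst.tendsto _).comp key, (continuous_snd.tendsto _).comp key⟩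

end IsKKT

end Program

/-- The decrease of a sequence that is nonincreasing and nonnegative from index one on tends to
zero. -/
theorem tendsto_sub_of_antitone_of_nonneg {V : ℕ → ℝ} (hV : ∀ k, 0 ≤ V k)
    (hdec : ∀ k, V (k + 2) ≤ V (k + 1)) :
    Tendsto (fun k => V k - V (k + 1)) atTop (𝓝 0) := by
  have hanti : Antitone fun k => V (k + 1) := antitone_nat_of_succ_le hdec
  have h1 := tendsto_atTop_ciInf hanti ⟨0, by rintro _ ⟨k, rfl⟩; exact hV _⟩
  have h2 := (tendsto_add_atTop_iff_nat 1).2 h1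
  rw [← tendsto_add_atTop_iff_nat 1]
  simpa using h1.sub h2

namespace Program

variable {m n p q : ℕ} {P : Program m n p q} {ρ : ℝ} {U : Set (E m)} {θ : E m}

namespace IsADMM

variable {xs : E n} {lams : E p} {nus : E q} {x : ℕ → E n} {s : ℕ → E q} {lam : ℕ → E p}
  {nu : ℕ → E q}

theorem stationary (h : P.IsADMM ρ θ x s lam nu) (hP : P.IsRegularAt U θ) (k : ℕ) :
    gradient (P.f θ) (x (k + 1)) + (P.A θ).adjoint (lam (k + 1))
      + (P.G θ).adjoint (nu k + ρ • (P.G θ (x (k + 1)) + s k - P.h θ)) = 0 := by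
  have hmin : IsLocalMin (fun y => P.augLag ρ θ y (s k) (lam k) (nu k)) (x (k + 1)) :=
    (h.primal k).isLocalMin univ_mem
  have := hmin.hasFDerivAt_eq_zero (hP.hasGradientAt_augLag ρ hP.mem _ _ _ _).hasFDerivAt
  rw [map_eq_zero_iff _ (InnerProductSpace.toDual ℝ (E n)).injective] at this
  rw [h.dual_eq]
  exact this

/-- Variational inequality for a single coordinate of the slack update. -/
theorem slack_variation (h : P.IsADMM ρ θ x s lam nu) (k : ℕ) (i : Fin q) {a : ℝ}
    (ha : 0 ≤ s (k + 1) i + a) : 0 ≤ nu (k + 1) i * a + ρ / 2 * a ^ 2 := by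
  have hmem : s (k + 1) + EuclideanSpace.single i a ∈ {t : E q | ∀ i, 0 ≤ t i} := by
    intro j
    rcases eq_or_ne j i with rfl | hj
    · simpa using ha
    · simpa [hj] using h.slack_nonneg k j
  have h1 : P.augLag ρ θ (x (k + 1)) (s (k + 1)) (lam k) (nu k) ≤
    P.augLag ρ θ (x (k + 1)) (s (k + 1) + EuclideanSpace.single i a) (lam k) (nu k) :=
    h.slack k hmem
  have h2 : P.G θ (x (k + 1)) + (s (k + 1) + EuclideanSpace.single i a) - P.h θ =
    (P.G θ (x (k + 1)) + s (k + 1) - P.h θ) + EuclideanSpace.single i a := by abel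
  have h3 : nu (k + 1) i =
      nu k i + ρ * (P.G θ (x (k + 1)) + s (k + 1) - P.h θ) i := by rw [h.dual_ineq]; simp
  rw [augLag, augLag, h2, inner_add_right, norm_add_sq_real, EuclideanSpace.inner_single_right,
    EuclideanSpace.inner_single_right, PiLp.norm_single, Real.norm_eq_abs, sq_abs] at h1
  rw [h3]
  simp only [RCLike.conj_to_real] at h1
  nlinarith

theorem nu_nonneg (h : P.IsADMM ρ θ x s lam nu) (hρ : 0 < ρ) (k : ℕ) (i : Fin q) :
    0 ≤ nu (k + 1) i := by
  by_contra! hneg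
  have h1 := h.slack_variation k i (a := -nu (k + 1) i / ρ)
    (add_nonneg (h.slack_nonneg k i) (div_nonneg (by linarith) hρ.le))
  have h2 : nu (k + 1) i * (-nu (k + 1) i / ρ) + ρ / 2 * (-nu (k + 1) i / ρ) ^ 2
    = -(nu (k + 1) i ^ 2 / (2 * ρ)) := by field_simp; ring
  have h3 : 0 < nu (k + 1) i ^ 2 / (2 * ρ) := by have := sq_pos_of_neg hneg; positivity
  linarith

theorem slack_mul_nu (h : P.IsADMM ρ θ x s lam nu) (hρ : 0 < ρ) (k : ℕ) (i : Fin q) :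
    s (k + 1) i * nu (k + 1) i = 0 := by
  by_contra hne
  have hs : 0 < s (k + 1) i := lt_of_le_of_ne (h.slack_nonneg k i) fun h0 => hne (by simp [← h0])
  have hn : 0 < nu (k + 1) i := lt_of_le_of_ne (h.nu_nonneg hρ k i) fun h0 => hne (by simp [← h0])
  set r := min (s (k + 1) i) (nu (k + 1) i / ρ)
  have hr : 0 < r := lt_min hs (div_pos hn hρ)
  have h1 := h.slack_variation k i (a := -r) (by linarith [min_le_left (s (k + 1) i) (nu (k + 1) i / ρ)])
  have h2 : ρ * r ≤ nu (k + 1) i := by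
    have := min_le_right (s (k + 1) i) (nu (k + 1) i / ρ)
    rwa [mul_comm, ← le_div_iff₀ hρ]
  nlinarith [mul_pos hn hr]

theorem energy_step (h : P.IsADMM ρ θ x s lam nu) (hP : P.IsRegularAt U θ)
    (hkkt : P.IsKKT θ xs lams nus) (k : ℕ) :
    ‖lam (k + 1) - lams‖ ^ 2
        + ‖nu (k + 1) - ρ • s (k + 1) - (nus - ρ • (P.h θ - P.G θ xs))‖ ^ 2 =
      ‖lam k - lams‖ ^ 2 + ‖nu k - ρ • s k - (nus - ρ • (P.h θ - P.G θ xs))‖ ^ 2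
        - ‖ρ • (P.A θ (x (k + 1)) - P.b θ)‖ ^ 2 - ‖ρ • (P.G θ (x (k + 1)) + s k - P.h θ)‖ ^ 2
        + 2 * (inner ℝ (ρ • (s k - (P.h θ - P.G θ xs))) (nu k - nus)
          - ρ * inner ℝ (gradient (P.f θ) (x (k + 1)) - gradient (P.f θ) xs) (x (k + 1) - xs)) := by
  have h1 := h.stationary hP k
  have h2 := hkkt.stationary
  have h3 := hkkt.eq_constraint
  have hu : nu (k + 1) - ρ • s (k + 1) = nu k + ρ • (P.G θ (x (k + 1)) - P.h θ) := by
    rw [h.dual_ineq]; module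
  have key := splitting_energy (ρ := ρ)
    (D := inner ℝ (gradient (P.f θ) (x (k + 1)) - gradient (P.f θ) xs) (x (k + 1) - xs))
    (l := lam k - lams) (l' := lam (k + 1) - lams) (a := P.A θ (x (k + 1) - xs))
    (ν := nu k - nus) (σ := ρ • (s k - (P.h θ - P.G θ xs))) (g := P.G θ (x (k + 1) - xs))
    (u := nu k - ρ • s k - (nus - ρ • (P.h θ - P.G θ xs)))
    (u' := nu (k + 1) - ρ • s (k + 1) - (nus - ρ • (P.h θ - P.G θ xs)))
    (by module) (by rw [h.dual_eq, map_sub, h3]; module) (by rw [hu, map_sub]; module)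
    (by
      rw [← ContinuousLinearMap.adjoint_inner_left, ← ContinuousLinearMap.adjoint_inner_left,
        ← inner_add_left, ← inner_add_left]
      convert inner_zero_left (𝕜 := ℝ) (x (k + 1) - xs) using 2
      have h4 : nu (k + 1) - ρ • s (k + 1) - (nus - ρ • (P.h θ - P.G θ xs))
          + ρ • (s k - (P.h θ - P.G θ xs)) =
        (nu k + ρ • (P.G θ (x (k + 1)) + s k - P.h θ)) - nus := by rw [hu]; module
      rw [h4, map_sub, map_sub]
      refine Eq.trans ?_ (sub_eq_zero.2 (h1.trans h2.symm))
      abel)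
  rw [key, show lam (k + 1) - lams - (lam k - lams) = ρ • (P.A θ (x (k + 1)) - P.b θ) by
      rw [h.dual_eq]; abel,
    show nu (k + 1) - ρ • s (k + 1) - (nus - ρ • (P.h θ - P.G θ xs))
      - (nu k - ρ • s k - (nus - ρ • (P.h θ - P.G θ xs))) =
      ρ • (P.G θ (x (k + 1)) + s k - P.h θ) by rw [hu]; module]

theorem tendsto_residuals (h : P.IsADMM ρ θ x s lam nu) (hρ : 0 < ρ) (hP : P.IsRegularAt U θ)
    (hkkt : P.IsKKT θ xs lams nus) :
    Tendsto (fun k => P.A θ (x (k + 1)) - P.b θ) atTop (𝓝 0) ∧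
    Tendsto (fun k => P.G θ (x (k + 1)) + s k - P.h θ) atTop (𝓝 0) ∧
    Tendsto (fun k => inner ℝ nus (s k)) atTop (𝓝 0) ∧
    Tendsto (fun k => inner ℝ (P.h θ - P.G θ xs) (nu k)) atTop (𝓝 0) ∧
    Tendsto (fun k => inner ℝ (gradient (P.f θ) (x (k + 1)) - gradient (P.f θ) xs) (x (k + 1) - xs))
      atTop (𝓝 0) := by
  set ss := P.h θ - P.G θ xs with hss
  set V : ℕ → ℝ := fun k => ‖lam k - lams‖ ^ 2 + ‖nu k - ρ • s k - (nus - ρ • ss)‖ ^ 2 with hV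
  set D : ℕ → ℝ := fun k =>
    inner ℝ (gradient (P.f θ) (x (k + 1)) - gradient (P.f θ) xs) (x (k + 1) - xs) with hD
  have hD0 : ∀ k, 0 ≤ D k := by
    intro k
    have h1 := inner_gradient_le_sub hP.convex (hP.hasGradientAt hP.mem (x (k + 1))) xs
    have h2 := inner_gradient_le_sub hP.convex (hP.hasGradientAt hP.mem xs) (x (k + 1))
    rw [← neg_sub, inner_neg_right] at h1
    simp only [hD, inner_sub_left]
    linarith
  have hss0 : ∀ i, 0 ≤ ss i := fun i => by simpa [hss] using hkkt.primal_feasible i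
  have hsn : inner ℝ ss nus = (0 : ℝ) := by
    have := hkkt.inner_nus
    rw [← neg_sub, inner_neg_right, neg_eq_zero, real_inner_comm] at this
    exact this
  have hc1 : ∀ k, 0 ≤ inner ℝ nus (s (k + 1)) := fun k => hkkt.inner_nus_nonneg (h.slack_nonneg k)
  have hc2 : ∀ k, 0 ≤ inner ℝ ss (nu (k + 1)) := fun k => by
    rw [PiLp.inner_apply]
    exact Finset.sum_nonneg fun i _ => mul_nonneg (h.nu_nonneg hρ k i) (hss0 i)
  have hc3 : ∀ k, inner ℝ (s (k + 1)) (nu (k + 1)) = (0 : ℝ) := fun k => by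
    rw [PiLp.inner_apply]
    exact Finset.sum_eq_zero fun i _ => by simpa [mul_comm] using h.slack_mul_nu hρ k i
  have hstep : ∀ k, V (k + 1) - V (k + 2) =
      ‖ρ • (P.A θ (x (k + 2)) - P.b θ)‖ ^ 2 + ‖ρ • (P.G θ (x (k + 2)) + s (k + 1) - P.h θ)‖ ^ 2
      + 2 * ρ * inner ℝ nus (s (k + 1)) + 2 * ρ * inner ℝ ss (nu (k + 1)) + 2 * ρ * D (k + 1) := by
    intro k
    have h1 := h.energy_step hP hkkt (k + 1)
    rw [← hss] at h1
    have h2 : inner ℝ (ρ • (s (k + 1) - ss)) (nu (k + 1) - nus) =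
        -(ρ * (inner ℝ nus (s (k + 1)) + inner ℝ ss (nu (k + 1)))) := by
      rw [inner_smul_left, inner_sub_left, inner_sub_right, inner_sub_right, hc3, hsn,
        real_inner_comm nus]
      simp only [RCLike.conj_to_real]
      ring
    rw [h2] at h1
    simp only [hV, hD]
    linarith
  have hnn : ∀ k, 0 ≤ ‖ρ • (P.A θ (x (k + 2)) - P.b θ)‖ ^ 2 ∧
      0 ≤ ‖ρ • (P.G θ (x (k + 2)) + s (k + 1) - P.h θ)‖ ^ 2 ∧
      0 ≤ 2 * ρ * inner ℝ nus (s (k + 1)) ∧ 0 ≤ 2 * ρ * inner ℝ ss (nu (k + 1)) ∧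
      0 ≤ 2 * ρ * D (k + 1) := fun k =>
    ⟨sq_nonneg _, sq_nonneg _, mul_nonneg (by positivity) (hc1 k),
      mul_nonneg (by positivity) (hc2 k), mul_nonneg (by positivity) (hD0 _)⟩
  have hlim : Tendsto (fun k => V (k + 1) - V (k + 2)) atTop (𝓝 0) := by
    refine (tendsto_add_atTop_iff_nat (f := fun k => V k - V (k + 1)) 1).2
      (tendsto_sub_of_antitone_of_nonneg (fun k => ?_) fun k => ?_)
    · simp only [hV]; positivity
    · have := hstep k
      obtain ⟨h1, h2, h3, h4, h5⟩ := hnn k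
      linarith
  have hsq : ∀ {d : ℕ} {r : ℕ → E d}, (∀ k, ‖ρ • r (k + 1)‖ ^ 2 ≤ V (k + 1) - V (k + 2)) →
      Tendsto r atTop (𝓝 0) := by
    intro d r hr
    have h1 : Tendsto (fun k => ‖ρ • r (k + 1)‖ ^ 2) atTop (𝓝 0) :=
      squeeze_zero (fun _ => sq_nonneg _) hr hlim
    have h2 : Tendsto (fun k => ‖ρ • r (k + 1)‖) atTop (𝓝 0) := by
      simpa [Real.sqrt_sq] using h1.sqrt
    have h3 := (tendsto_zero_iff_norm_tendsto_zero.2 h2).const_smul ρ⁻¹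
    rw [← tendsto_add_atTop_iff_nat 1]
    simpa [smul_smul, inv_mul_cancel₀ hρ.ne'] using h3
  have hre : ∀ {r : ℕ → ℝ}, (∀ k, 0 ≤ r (k + 1)) →
      (∀ k, 2 * ρ * r (k + 1) ≤ V (k + 1) - V (k + 2)) → Tendsto r atTop (𝓝 0) := by
    intro r hr0 hr
    have h1 : Tendsto (fun k => (2 * ρ)⁻¹ * (V (k + 1) - V (k + 2))) atTop (𝓝 0) := by
      simpa using hlim.const_mul (2 * ρ)⁻¹
    rw [← tendsto_add_atTop_iff_nat 1]
    refine squeeze_zero hr0 (fun k => ?_) h1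
    rw [← div_eq_inv_mul, le_div_iff₀ (by positivity), mul_comm]
    exact hr k
  refine ⟨hsq fun k => ?_, hsq fun k => ?_, hre hc1 fun k => ?_, hre hc2 fun k => ?_,
    hre (fun k => hD0 (k + 1)) fun k => ?_⟩
  all_goals
    obtain ⟨h1, h2, h3, h4, h5⟩ := hnn k
    have := hstep k
    simp only [hD, hV] at *
    linarith

theorem tendsto_primal (h : P.IsADMM ρ θ x s lam nu) (hρ : 0 < ρ) (hP : P.IsRegularAt U θ)
    (hkkt : P.IsKKT θ xs lams nus) (hinv : (P.kktJac θ (xs, lams, nus)).IsInvertible) :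
    Tendsto x atTop (𝓝 xs) ∧ Tendsto s atTop (𝓝 (P.h θ - P.G θ xs)) := by
  obtain ⟨h1, h2, h3, -, h5⟩ := h.tendsto_residuals hρ hP hkkt
  rw [← tendsto_add_atTop_iff_nat (f := x) 1]
  refine hkkt.tendsto_of_augLag hP hinv ?_ ?_
  · filter_upwards [eventually_ge_atTop 1] with k hk i
    obtain ⟨j, rfl⟩ := Nat.exists_eq_add_of_le' hk
    exact h.slack_nonneg j i
  · have h6 : Tendsto (fun k => P.augLag 0 θ (x (k + 1)) 0 lams nus) atTop (𝓝 (P.f θ xs)) := by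
      refine tendsto_of_tendsto_of_tendsto_of_le_of_le tendsto_const_nhds
        (by simpa using h5.const_add (P.f θ xs)) (fun k => hkkt.le_lagrangian hP _) fun k => ?_
      have := inner_gradient_le_sub (IsKKT.convexOn_lagrangian hP lams nus)
        (hkkt.hasGradientAt_lagrangian hP (x (k + 1))) xs
      rw [hkkt.lagrangian_self, ← neg_sub (x (k + 1)) xs, inner_neg_right] at this
      simp only
      linarith
    have h7 := ((h6.add h3).add (h1.norm.pow 2)).add (h2.norm.pow 2)
    simpa [IsKKT.augLag_two] using h7

theorem tendsto_dual (h : P.IsADMM ρ θ x s lam nu) (hρ : 0 < ρ) (hP : P.IsRegularAt U θ)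
    (hkkt : P.IsKKT θ xs lams nus) (hinv : (P.kktJac θ (xs, lams, nus)).IsInvertible) :
    Tendsto lam atTop (𝓝 lams) ∧ Tendsto nu atTop (𝓝 nus) := by
  obtain ⟨h1, h2, -, h4, -⟩ := h.tendsto_residuals hρ hP hkkt
  have hx := (h.tendsto_primal hρ hP hkkt hinv).1
  set J := P.kktJac θ (xs, lams, nus) with hJ
  have hJk : ∀ k, J (0, lam k - lams, nu k - nus) =
      (gradient (P.f θ) xs - gradient (P.f θ) (x (k + 1))
        - (P.A θ).adjoint (ρ • (P.A θ (x (k + 1)) - P.b θ))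
        - (P.G θ).adjoint (ρ • (P.G θ (x (k + 1)) + s k - P.h θ)), 0,
        WithLp.toLp 2 fun i => -(nu k i * (P.h θ - P.G θ xs) i)) := by
    intro k
    have h5 := h.stationary hP k
    have h6 := hkkt.stationary
    rw [hJ, hP.kktJac_apply]
    refine Prod.ext ?_ (Prod.ext (map_zero _) ?_)
    · rw [h.dual_eq, map_add, map_add] at h5
      simp only [map_zero, zero_add, map_sub (P.A θ).adjoint (lam k), map_sub (P.G θ).adjoint (nu k)]
      rw [← sub_eq_zero]
      refine Eq.trans ?_ (sub_eq_zero.2 (h5.trans h6.symm))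
      abel
    · ext i
      have := hkkt.complementary i
      simp at this ⊢
      rcases this with h7 | h7
      · simp [h7]; ring
      · simp [sub_eq_zero.1 h7]
  have hn : ∀ i, Tendsto (fun k => nu k i * (P.h θ - P.G θ xs) i) atTop (𝓝 0) := by
    intro i
    have hss0 : ∀ i, 0 ≤ (P.h θ - P.G θ xs) i := fun i => by simpa using hkkt.primal_feasible i
    rw [← tendsto_add_atTop_iff_nat 1] at h4 ⊢
    refine squeeze_zero (fun k => mul_nonneg (h.nu_nonneg hρ k i) (hss0 i)) (fun k => ?_) h4
    rw [PiLp.inner_apply]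
    exact Finset.single_le_sum (f := fun i => nu (k + 1) i * (P.h θ - P.G θ xs) i)
      (fun i _ => mul_nonneg (h.nu_nonneg hρ k i) (hss0 i)) (Finset.mem_univ i)
  have hlim : Tendsto (fun k => J (0, lam k - lams, nu k - nus)) atTop (𝓝 0) := by
    simp only [hJk]
    refine Tendsto.prodMk_nhds ?_ (tendsto_const_nhds.prodMk_nhds ?_)
    · have h5 := (hP.continuous_gradient.tendsto xs).comp
        ((tendsto_add_atTop_iff_nat (f := x) 1).2 hx)
      have h6 := ((P.A θ).adjoint.continuous.tendsto _).comp (h1.const_smul ρ)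
      have h7 := ((P.G θ).adjoint.continuous.tendsto _).comp (h2.const_smul ρ)
      simpa [Function.comp_def] using ((h5.const_sub (gradient (P.f θ) xs)).sub h6).sub h7
    · have h8 := (PiLp.continuous_toLp 2 (fun _ : Fin q => ℝ)).tendsto 0 |>.comp
        (tendsto_pi_nhds.2 fun i => by simpa using (hn i).neg)
      exact h8
  have h9 := (J.inverse.continuous.tendsto 0).comp hlim
  simp only [Function.comp_def, hinv.inverse_apply_self, map_zero] at h9
  have h10 := (continuous_snd.tendsto _).comp h9
  have h11 := (continuous_fst.tendsto _).comp h10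
  have h12 := (continuous_snd.tendsto _).comp h10
  exact ⟨tendsto_sub_nhds_zero_iff.1 h11, tendsto_sub_nhds_zero_iff.1 h12⟩

/-- The activity pattern of the slack variables is identified after finitely many steps. -/
theorem eventually_sgn_eq (h : P.IsADMM ρ θ x s lam nu) (hρ : 0 < ρ) (hP : P.IsRegularAt U θ)
    (hkkt : P.IsKKT θ xs lams nus) (hinv : (P.kktJac θ (xs, lams, nus)).IsInvertible) :
    ∀ᶠ k in atTop, ∀ i, sgn (s k i) = sgn ((P.h θ - P.G θ xs) i) := by
  rw [eventually_all]
  intro i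
  have hs : Tendsto (fun k => s k i) atTop (𝓝 ((P.h θ - P.G θ xs) i)) :=
    ((PiLp.proj 2 (fun _ : Fin q => ℝ) i : E q →L[ℝ] ℝ).continuous.tendsto _).comp
      (h.tendsto_primal hρ hP hkkt hinv).2
  have hn : Tendsto (fun k => nu k i) atTop (𝓝 (nus i)) :=
    ((PiLp.proj 2 (fun _ : Fin q => ℝ) i : E q →L[ℝ] ℝ).continuous.tendsto _).comp
      (h.tendsto_dual hρ hP hkkt hinv).2
  by_cases hi : 0 < (P.h θ - P.G θ xs) i
  · filter_upwards [hs.eventually (lt_mem_nhds hi)] with k hk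
    simp only [sgn, if_pos hk, if_pos hi]
  · have h0 : (P.G θ xs - P.h θ) i = 0 := by
      have := hkkt.primal_feasible i
      simp at hi ⊢
      linarith
    have hpos : 0 < nus i :=
      lt_of_le_of_ne (hkkt.dual_nonneg i) (IsKKT.strict_complementary hP hinv i h0).symm
    filter_upwards [hn.eventually (lt_mem_nhds hpos), eventually_ge_atTop 1] with k hk hk1
    obtain ⟨j, rfl⟩ := Nat.exists_eq_add_of_le' hk1
    have : s (j + 1) i = 0 := (mul_eq_zero.1 (h.slack_mul_nu hρ j i)).resolve_right hk.ne'
    simp only [sgn, this, lt_irrefl, if_false, if_neg hi]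

end IsADMM

end Program

/-- Pointwise convergence of linear maps on a Euclidean space is convergence in norm. -/
theorem tendsto_clm_of_forall_tendsto_apply {m : ℕ} {W : Type*} [NormedAddCommGroup W]
    [NormedSpace ℝ W] {X : ℕ → E m →L[ℝ] W} {X' : E m →L[ℝ] W}
    (h : ∀ v, Tendsto (fun k => X k v) atTop (𝓝 (X' v))) : Tendsto X atTop (𝓝 X') := by
  have hsum : ∀ L : E m →L[ℝ] W, L = ∑ i, ContinuousLinearMap.smulRightL ℝ (E m) W
      (EuclideanSpace.proj i) (L (EuclideanSpace.single i 1)) := by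
    intro L
    refine ContinuousLinearMap.coe_injective
      ((EuclideanSpace.basisFun (Fin m) ℝ).toBasis.ext fun j => ?_)
    simp
  rw [hsum X']
  refine Tendsto.congr (fun k => (hsum (X k)).symm) (tendsto_finsetSum _ fun i _ => ?_)
  exact (ContinuousLinearMap.continuous _).tendsto _ |>.comp (h _)

/-- Entrywise multiplication by a fixed vector. -/
noncomputable def diagCLM {q : ℕ} (d : Fin q → ℝ) : E q →L[ℝ] E q :=
  LinearMap.toContinuousLinearMap
    { toFun := fun u => WithLp.toLp 2 fun i => d i * u i
      map_add' := fun u v => by ext i; simp [mul_add]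
      map_smul' := fun a u => by ext i; simp; ring }

@[simp] theorem diagCLM_apply {q : ℕ} (d : Fin q → ℝ) (u : E q) (i : Fin q) :
    diagCLM d u i = d i * u i := rfl

/-- The stacked constraint map `x ↦ (A x, G x)` into the Euclidean product. -/
noncomputable def stackCLM {n p q : ℕ} (A : E n →L[ℝ] E p) (G : E n →L[ℝ] E q) :
    E n →L[ℝ] WithLp 2 (E p × E q) :=
  (WithLp.prodContinuousLinearEquiv 2 ℝ (E p) (E q)).symm.toContinuousLinearMap.comp (A.prod G)

theorem stackCLM_apply {n p q : ℕ} (A : E n →L[ℝ] E p) (G : E n →L[ℝ] E q) (x : E n) :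
    stackCLM A G x = WithLp.toLp 2 (A x, G x) := rfl

theorem adjoint_stackCLM_apply {n p q : ℕ} (A : E n →L[ℝ] E p) (G : E n →L[ℝ] E q)
    (y : WithLp 2 (E p × E q)) :
    (stackCLM A G).adjoint y = A.adjoint y.fst + G.adjoint y.snd := by
  refine ext_inner_right ℝ fun w => ?_
  rw [ContinuousLinearMap.adjoint_inner_left, inner_add_left,
    ContinuousLinearMap.adjoint_inner_left, ContinuousLinearMap.adjoint_inner_left,
    WithLp.prod_inner_apply]
  rfl

/-- The map `(l, u) ↦ (l, d * u)` on the Euclidean product. -/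
noncomputable def maskCLM {q : ℕ} (p : ℕ) (d : Fin q → ℝ) :
    WithLp 2 (E p × E q) →L[ℝ] WithLp 2 (E p × E q) :=
  (WithLp.prodContinuousLinearEquiv 2 ℝ (E p) (E q)).symm.toContinuousLinearMap.comp
    (((ContinuousLinearMap.id ℝ (E p)).prodMap (diagCLM d)).comp
      (WithLp.prodContinuousLinearEquiv 2 ℝ (E p) (E q)).toContinuousLinearMap)

theorem maskCLM_apply {p q : ℕ} (d : Fin q → ℝ) (y : WithLp 2 (E p × E q)) :
    maskCLM p d y = WithLp.toLp 2 (y.fst, diagCLM d y.snd) := rfl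

theorem inner_maskCLM_sub {p q : ℕ} {d : Fin q → ℝ} (hd : ∀ i, d i * (1 - d i) = 0)
    (y z : WithLp 2 (E p × E q)) :
    inner ℝ (maskCLM p d y) (z - maskCLM p d z) = 0 := by
  rw [WithLp.prod_inner_apply]
  have h1 : ∀ i, inner ℝ (d i * y.snd i) (z.snd i - d i * z.snd i) = 0 := fun i => by
    simp only [RCLike.inner_apply, RCLike.conj_to_real]
    linear_combination (y.snd i * z.snd i) * hd i
  have h2 : inner ℝ (maskCLM p d y).snd (z - maskCLM p d z).snd = 0 := by
    rw [PiLp.inner_apply]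
    exact Finset.sum_eq_zero fun i _ => h1 i
  have h3 : (z - maskCLM p d z).fst = 0 := sub_self _
  exact (congrArg₂ (· + ·) (by rw [← inner_zero_right (𝕜 := ℝ) (maskCLM p d y).fst, ← h3]; rfl) h2).trans
    (add_zero 0)

namespace Program

variable {m n p q : ℕ} {P : Program m n p q} {ρ : ℝ} {U : Set (E m)} {θ : E m}

theorem sgn_eq_zero_or_one (t : ℝ) : sgn t = 0 ∨ sgn t = 1 := by
  unfold sgn; split_ifs <;> simp

theorem IsRegularAt.inner_hess_nonneg (hP : P.IsRegularAt U θ) (x d : E n) :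
    0 ≤ inner ℝ d (P.hess θ x d) := by
  set g : ℝ → ℝ := fun t => inner ℝ d (gradient (P.f θ) (x + t • d)) with hg
  have hmono : Monotone g := by
    intro a b hab
    rcases hab.eq_or_lt with rfl | hlt
    · exact le_rfl
    have h1 := inner_gradient_le_sub hP.convex (hP.hasGradientAt hP.mem (x + a • d)) (x + b • d)
    have h2 := inner_gradient_le_sub hP.convex (hP.hasGradientAt hP.mem (x + b • d)) (x + a • d)
    rw [show x + b • d - (x + a • d) = (b - a) • d by module, inner_smul_right,
      real_inner_comm] at h1
    rw [show x + a • d - (x + b • d) = (a - b) • d by module, inner_smul_right,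
      real_inner_comm] at h2
    simp only [hg]
    nlinarith
  have hline : HasDerivAt (fun t : ℝ => x + t • d) d 0 := by
    simpa using ((hasDerivAt_id (0 : ℝ)).smul_const d).const_add x
  have hd : HasDerivAt g (inner ℝ d (P.hess θ x d)) 0 := by
    have h3 : HasFDerivAt (gradient (P.f θ)) (P.hess θ x) (x + (0 : ℝ) • d) := by
      simpa using hP.hasFDerivAt_gradient x
    have h4 := (innerSL ℝ d).hasFDerivAt.comp_hasDerivAt (0 : ℝ) (h3.comp_hasDerivAt (0 : ℝ) hline)
    exact h4
  exact hd.deriv ▸ hmono.deriv_nonneg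

namespace IsKKT

variable {xs : E n} {lams : E p} {nus : E q}

/-- The indicator of the active constraints, as given by the slack `h - G x⋆`. -/
noncomputable def activity (P : Program m n p q) (θ : E m) (xs : E n) (i : Fin q) : ℝ :=
  1 - sgn ((P.h θ - P.G θ xs) i)

/-- A pair solving the linearized splitting equations solves the linearized complementarity
system. -/
theorem linearized_complementarity (h : P.IsKKT θ xs lams nus) (hρ : 0 < ρ) {g e u : E q}
    (hu : ρ • (g + e) = u - diagCLM (activity P θ xs) u) (i : Fin q) :
    nus i * g i + diagCLM (activity P θ xs) u i * (P.G θ xs - P.h θ) i = -(nus i * e i) := by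
  have h1 := congrArg (fun z : E q => z i) hu
  have h2 := h.complementary i
  have h3 := h.primal_feasible i
  simp only [PiLp.smul_apply, PiLp.add_apply, PiLp.sub_apply, diagCLM_apply, activity,
    smul_eq_mul] at h1 h2 ⊢
  by_cases hi : 0 < P.h θ i - P.G θ xs i
  · have h4 : nus i = 0 := (mul_eq_zero.1 h2).resolve_right (by linarith)
    simp [sgn, hi, h4]
  · have h4 : P.G θ xs i - P.h θ i = 0 := by linarith
    simp only [sgn, if_neg hi] at h1
    have h5 : g i + e i = 0 := by
      have : ρ * (g i + e i) = 0 := by rw [h1]; ring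
      exact (mul_eq_zero.1 this).resolve_left hρ.ne'
    rw [h4, eq_neg_of_add_eq_zero_left h5]
    ring

theorem splitting_injective (h : P.IsKKT θ xs lams nus) (hP : P.IsRegularAt U θ)
    (hinv : (P.kktJac θ (xs, lams, nus)).IsInvertible) (hρ : 0 < ρ) (x : E n)
    (y : WithLp 2 (E p × E q))
    (h1 : P.hess θ xs x + (stackCLM (P.A θ) (P.G θ)).adjoint (maskCLM p (activity P θ xs) y) = 0)
    (h2 : ρ • stackCLM (P.A θ) (P.G θ) x = y - maskCLM p (activity P θ xs) y) : x = 0 ∧ y = 0 := by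
  rw [adjoint_stackCLM_apply] at h1
  have hA : ρ • P.A θ x = 0 :=
    (congrArg WithLp.fst h2).trans (sub_self _)
  have hG : ρ • (P.G θ x + 0) = y.snd - diagCLM (activity P θ xs) y.snd := by
    rw [add_zero]; exact congrArg WithLp.snd h2
  have hJ : P.kktJac θ (xs, lams, nus) (x, y.fst, diagCLM (activity P θ xs) y.snd) = 0 := by
    rw [hP.kktJac_apply]
    refine Prod.ext ?_ (Prod.ext ((smul_eq_zero.1 hA).resolve_left hρ.ne') ?_)
    · exact (add_assoc _ _ _).trans h1
    · ext i
      simpa using h.linearized_complementarity hρ hG i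
  have h0 := hinv.injective (hJ.trans (map_zero _).symm)
  have hx : x = 0 := congrArg Prod.fst h0
  refine ⟨hx, ?_⟩
  have h3 : y.fst = 0 := congrArg (fun z => z.2.1) h0
  have h4 : diagCLM (activity P θ xs) y.snd = 0 := congrArg (fun z => z.2.2) h0
  rw [hx, map_zero, add_zero, smul_zero, h4, sub_zero] at hG
  exact WithLp.ofLp_injective 2 (Prod.ext h3 hG.symm)

theorem implicitJac_apply_eq (h : P.IsKKT θ xs lams nus) (hP : P.IsRegularAt U θ)
    (hinv : (P.kktJac θ (xs, lams, nus)).IsInvertible) (hρ : 0 < ρ) {v : E m} {x : E n}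
    {y : WithLp 2 (E p × E q)}
    (h1 : P.hess θ xs x + (stackCLM (P.A θ) (P.G θ)).adjoint (maskCLM p (activity P θ xs) y)
      + (P.gradDeriv θ xs (v, 0) + (fderiv ℝ P.A θ v).adjoint lams
        + (fderiv ℝ P.G θ v).adjoint nus) = 0)
    (h2 : ρ • (stackCLM (P.A θ) (P.G θ) x + WithLp.toLp 2 (fderiv ℝ P.A θ v xs - fderiv ℝ P.b θ v,
      fderiv ℝ P.G θ v xs - fderiv ℝ P.h θ v)) = y - maskCLM p (activity P θ xs) y) :
    P.implicitJac θ (xs, lams, nus) v = x := by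
  rw [adjoint_stackCLM_apply] at h1
  have hA : ρ • (P.A θ x + (fderiv ℝ P.A θ v xs - fderiv ℝ P.b θ v)) = 0 :=
    (congrArg WithLp.fst h2).trans (sub_self _)
  have hG : ρ • (P.G θ x + (fderiv ℝ P.G θ v xs - fderiv ℝ P.h θ v))
      = y.snd - diagCLM (activity P θ xs) y.snd := congrArg WithLp.snd h2
  have hJ : P.kktJac θ (xs, lams, nus) (x, y.fst, diagCLM (activity P θ xs) y.snd)
      = -P.kktJacParam θ (xs, lams, nus) v := by
    rw [hP.kktJac_apply, hP.kktJacParam_apply]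
    refine Prod.ext ?_ (Prod.ext ?_ ?_)
    · exact eq_neg_of_add_eq_zero_left
        ((congrArg (· + _) (add_assoc (P.hess θ xs x) _ _)).trans h1)
    · exact eq_neg_of_add_eq_zero_left ((smul_eq_zero.1 hA).resolve_left hρ.ne')
    · ext i
      exact h.linearized_complementarity hρ hG i
  have h3 : P.implicitJac θ (xs, lams, nus) v =
      ((P.kktJac θ (xs, lams, nus)).inverse (-P.kktJacParam θ (xs, lams, nus) v)).1 := by
    simp [implicitJac]
  rw [h3, ← hJ, hinv.inverse_apply_self]

end IsKKT

namespace IsAltDiff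

variable {x : ℕ → E n} {s : ℕ → E q} {lam : ℕ → E p} {nu : ℕ → E q}
  {X : ℕ → E m →L[ℝ] E n} {S : ℕ → E m →L[ℝ] E q} {Lam : ℕ → E m →L[ℝ] E p}
  {Nu : ℕ → E m →L[ℝ] E q}

theorem stationary (h : P.IsAltDiff ρ θ x s lam nu X S Lam Nu) (hP : P.IsRegularAt U θ)
    (hhess : ∀ k, (P.hessL ρ θ (x (k + 1)) (s k) (lam k) (nu k)).IsInvertible) (k : ℕ) (v : E m) :
    P.hess θ (x (k + 1)) (X (k + 1) v)
      + ((P.A θ).adjoint (Lam k v + ρ • (P.A θ (X (k + 1) v)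
          + (fderiv ℝ P.A θ v (x (k + 1)) - fderiv ℝ P.b θ v)))
        + (P.G θ).adjoint (Nu k v + ρ • S k v + ρ • (P.G θ (X (k + 1) v)
          + (fderiv ℝ P.G θ v (x (k + 1)) - fderiv ℝ P.h θ v))))
      + (P.gradDeriv θ (x (k + 1)) (v, 0)
        + (fderiv ℝ P.A θ v).adjoint (lam k + ρ • (P.A θ (x (k + 1)) - P.b θ))
        + (fderiv ℝ P.G θ v).adjoint (nu k + ρ • (P.G θ (x (k + 1)) + s k - P.h θ))) = 0 := by
  have h1 : P.hessL ρ θ (x (k + 1)) (s k) (lam k) (nu k) (X (k + 1) v) +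
      P.mixedL ρ θ (x (k + 1)) (s k) (lam k) (nu k) (S k) (Lam k) (Nu k) v = 0 := by
    rw [h.primal]
    simp [(hhess k).self_apply_inverse]
  rw [hP.hessL_apply, hP.mixedL_apply] at h1
  refine Eq.trans ?_ h1
  simp only [map_add, map_sub, map_smul, smul_add, smul_sub]
  abel

theorem dual_sub_slack (h : P.IsAltDiff ρ θ x s lam nu X S Lam Nu) (hP : P.IsRegularAt U θ)
    (k : ℕ) (v : E m) :
    Nu (k + 1) v - ρ • S (k + 1) v = Nu k v + ρ • (P.G θ (X (k + 1) v)
      + (fderiv ℝ P.G θ v (x (k + 1)) - fderiv ℝ P.h θ v)) := by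
  rw [h.dual_ineq, add_apply, smul_apply, hP.slackJac_apply]
  module

theorem diagCLM_dual_sub_slack (h : P.IsAltDiff ρ θ x s lam nu X S Lam Nu)
    (hP : P.IsRegularAt U θ) (hρ : 0 < ρ) (k : ℕ) (v : E m) :
    diagCLM (fun i => 1 - sgn (s (k + 1) i)) (Nu (k + 1) v - ρ • S (k + 1) v) = Nu (k + 1) v := by
  ext i
  have h1 := congrArg (fun z : E q => z i) (h.dual_sub_slack hP k v)
  have h2 := h.slack k v i
  rw [hP.ineqJac_apply] at h2
  simp only [diagCLM_apply, PiLp.smul_apply, PiLp.add_apply, PiLp.sub_apply, smul_eq_mul] at h1 h2 ⊢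
  have h3 : ρ * S (k + 1) v i = -sgn (s (k + 1) i) * (Nu (k + 1) v i - ρ * S (k + 1) v i) := by
    rw [h1, h2]; field_simp; ring
  linear_combination -h3

theorem tendsto_apply (h : P.IsAltDiff ρ θ x s lam nu X S Lam Nu) (hadmm : P.IsADMM ρ θ x s lam nu)
    (hP : P.IsRegularAt U θ) (hρ : 0 < ρ)
    (hhess : ∀ k, (P.hessL ρ θ (x (k + 1)) (s k) (lam k) (nu k)).IsInvertible)
    {xs : E n} {lams : E p} {nus : E q} (hkkt : P.IsKKT θ xs lams nus)
    (hinv : (P.kktJac θ (xs, lams, nus)).IsInvertible) (v : E m) :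
    Tendsto (fun k => X k v) atTop (𝓝 (P.implicitJac θ (xs, lams, nus) v)) := by
  obtain ⟨hx, -⟩ := hadmm.tendsto_primal hρ hP hkkt hinv
  obtain ⟨hlam, hnu⟩ := hadmm.tendsto_dual hρ hP hkkt hinv
  obtain ⟨hr1, hr2, -⟩ := hadmm.tendsto_residuals hρ hP hkkt
  have hx' : Tendsto (fun k => x (k + 1)) atTop (𝓝 xs) := (tendsto_add_atTop_iff_nat 1).2 hx
  have hmask : ∀ᶠ k in atTop,
      diagCLM (IsKKT.activity P θ xs) (Nu k v - ρ • S k v) = Nu k v := by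
    filter_upwards [hadmm.eventually_sgn_eq hρ hP hkkt hinv, eventually_ge_atTop 1] with k hk hk1
    obtain ⟨j, rfl⟩ := Nat.exists_eq_add_of_le' hk1
    have hact : IsKKT.activity P θ xs = fun i => 1 - sgn (s (j + 1) i) :=
      funext fun i => by rw [IsKKT.activity, hk i]
    rw [hact]
    exact h.diagCLM_dual_sub_slack hP hρ j v
  obtain ⟨x', y', hlim, h1, h2⟩ := exists_tendsto_of_affine_splitting
    (M := stackCLM (P.A θ) (P.G θ)) (H := P.hess θ xs) (Q := maskCLM p (IsKKT.activity P θ xs))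
    (Hk := fun k => P.hess θ (x (k + 1))) (x := fun k => X k v)
    (y := fun k => WithLp.toLp 2 (Lam k v, Nu k v - ρ • S k v))
    (ck := fun k => P.gradDeriv θ (x (k + 1)) (v, 0)
        + (fderiv ℝ P.A θ v).adjoint (lam k + ρ • (P.A θ (x (k + 1)) - P.b θ))
        + (fderiv ℝ P.G θ v).adjoint (nu k + ρ • (P.G θ (x (k + 1)) + s k - P.h θ)))
    (c := P.gradDeriv θ xs (v, 0) + (fderiv ℝ P.A θ v).adjoint lams
        + (fderiv ℝ P.G θ v).adjoint nus)
    (ek := fun k => WithLp.toLp 2 (fderiv ℝ P.A θ v (x (k + 1)) - fderiv ℝ P.b θ v,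
      fderiv ℝ P.G θ v (x (k + 1)) - fderiv ℝ P.h θ v))
    (e := WithLp.toLp 2 (fderiv ℝ P.A θ v xs - fderiv ℝ P.b θ v,
      fderiv ℝ P.G θ v xs - fderiv ℝ P.h θ v))
    hρ (hP.inner_hess_nonneg xs)
    (inner_maskCLM_sub fun i => by
      rcases sgn_eq_zero_or_one ((P.h θ - P.G θ xs) i) with h0 | h0 <;>
        simp [IsKKT.activity] at h0 ⊢ <;> simp [h0])
    (hkkt.splitting_injective hP hinv hρ)
    ((hP.continuous_hess.tendsto xs).comp hx')
    (by
      have h3 := tendsto_clm_apply ((hP.continuous_gradDeriv.tendsto xs).comp hx')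
        (tendsto_const_nhds (x := ((v, 0) : E m × E n)))
      have h4 : Tendsto (fun k => lam k + ρ • (P.A θ (x (k + 1)) - P.b θ)) atTop (𝓝 lams) := by
        simpa using hlam.add (hr1.const_smul ρ)
      have h5 : Tendsto (fun k => nu k + ρ • (P.G θ (x (k + 1)) + s k - P.h θ)) atTop (𝓝 nus) := by
        simpa using hnu.add (hr2.const_smul ρ)
      exact (h3.add (((fderiv ℝ P.A θ v).adjoint.continuous.tendsto _).comp h4)).add
        (((fderiv ℝ P.G θ v).adjoint.continuous.tendsto _).comp h5))
    (by
      refine ((WithLp.prod_continuous_toLp 2 (E p) (E q)).tendsto _).comp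
        (Tendsto.prodMk_nhds ?_ ?_)
      · exact (((fderiv ℝ P.A θ v).continuous.tendsto _).comp hx').sub_const _
      · exact (((fderiv ℝ P.G θ v).continuous.tendsto _).comp hx').sub_const _)
    (by
      filter_upwards [hmask] with k hk
      refine Eq.trans ?_ (h.stationary hP hhess k v)
      rw [adjoint_stackCLM_apply, maskCLM_apply, stackCLM_apply]
      simp only [WithLp.toLp_fst, WithLp.toLp_snd, hk]
      refine congrArg (· + _) (congrArg (P.hess θ (x (k + 1)) (X (k + 1) v) + ·)
        (congrArg₂ (fun a b => (P.A θ).adjoint a + (P.G θ).adjoint b) ?_ ?_))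
      · change (2 : ℝ) • Lam k v - Lam k v + ρ • (P.A θ (X (k + 1) v)
          + (fderiv ℝ P.A θ v (x (k + 1)) - fderiv ℝ P.b θ v)) = _
        module
      · change (2 : ℝ) • Nu k v - (Nu k v - ρ • S k v) + ρ • (P.G θ (X (k + 1) v)
          + (fderiv ℝ P.G θ v (x (k + 1)) - fderiv ℝ P.h θ v)) = _
        module)
    (by
      filter_upwards [hmask] with k hk
      rw [maskCLM_apply, stackCLM_apply, h.dual_sub_slack hP, h.dual_eq]
      simp only [WithLp.toLp_fst, WithLp.toLp_snd, hk]
      rw [add_apply, smul_apply, hP.eqJac_apply, add_sub_assoc]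
      rfl)
  rwa [hkkt.implicitJac_apply_eq hP hinv hρ h1 h2]

end IsAltDiff

end Program

end AltDiff

theorem theorem4p2 {m n p q : ℕ} (P : AltDiff.Program m n p q) (ρ : ℝ) (hρ : 0 < ρ)
    (U : Set (AltDiff.E m)) (hU : IsOpen U) (θ : AltDiff.E m) (hθ : θ ∈ U)
    -- the objective is convex in x, and the data make the KKT map continuously differentiable
    (hconv : ConvexOn ℝ Set.univ (P.f θ))
    (hdiff : ∀ θ' ∈ U, Differentiable ℝ (P.f θ'))
    (hgrad : ContDiffOn ℝ 1 (fun w : AltDiff.E m × AltDiff.E n => gradient (P.f w.1) w.2)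
      (U ×ˢ Set.univ))
    (hA : ContDiffOn ℝ 1 P.A U) (hb : ContDiffOn ℝ 1 P.b U)
    (hG : ContDiffOn ℝ 1 P.G U) (hh : ContDiffOn ℝ 1 P.h U)
    -- the optimal solution, at which the KKT conditions can be differentiated implicitly
    (xs : AltDiff.E n) (lams : AltDiff.E p) (nus : AltDiff.E q)
    (hkkt : P.IsKKT θ xs lams nus)
    (hinv : (P.kktJac θ (xs, lams, nus)).IsInvertible)
    -- the iterates and their Jacobians
    (x : ℕ → AltDiff.E n) (s : ℕ → AltDiff.E q) (lam : ℕ → AltDiff.E p) (nu : ℕ → AltDiff.E q)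
    (hadmm : P.IsADMM ρ θ x s lam nu)
    (hhess : ∀ k, (P.hessL ρ θ (x (k + 1)) (s k) (lam k) (nu k)).IsInvertible)
    (X : ℕ → AltDiff.E m →L[ℝ] AltDiff.E n) (S : ℕ → AltDiff.E m →L[ℝ] AltDiff.E q)
    (Lam : ℕ → AltDiff.E m →L[ℝ] AltDiff.E p) (Nu : ℕ → AltDiff.E m →L[ℝ] AltDiff.E q)
    (haltdiff : P.IsAltDiff ρ θ x s lam nu X S Lam Nu) :
    Filter.Tendsto X Filter.atTop (nhds (P.implicitJac θ (xs, lams, nus))) := by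
  have hU' : U ∈ nhds θ := hU.mem_nhds hθ
  have hP : P.IsRegularAt U θ :=
    { mem_nhds := hU'
      convex := hconv
      differentiable := hdiff
      grad := fun x => hgrad.contDiffAt ((hU.prod isOpen_univ).mem_nhds ⟨hθ, Set.mem_univ x⟩)
      A := (hA.contDiffAt hU').differentiableAt one_ne_zero
      b := (hb.contDiffAt hU').differentiableAt one_ne_zero
      G := (hG.contDiffAt hU').differentiableAt one_ne_zero
      h := (hh.contDiffAt hU').differentiableAt one_ne_zero }
  exact AltDiff.tendsto_clm_of_forall_tendsto_apply
    (haltdiff.tendsto_apply hadmm hP hρ hhess hkkt hinv)
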